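/- Let $n\ge 3$ and $\lambda>n-1$, let $D=\{z\in\mathbb C^n : |z|<1,\ 2|z|^2<1+|z^\top z|^2\}$ be the Cartan domain of type IV, let $v_\lambda$ be the probability measure on $D$ whose density with respect to Lebesgue measure is a constant multiple of $(1-2|z|^2+|z^\top z|^2)^{\lambda-n}$, and let $\mathcal A^2_\lambda(D)$ be the weighted Bergman space of all holomorphic functions in $L^2(D,v_\lambda)$. Identify $\mathrm{SO}(2)$ with the unit circle in $\mathbb C$, let $\mathrm{SO}(n)\times\mathrm{SO}(2)$ act on $D$ by $(A,t)\cdot z=tAz$, and let $\pi_\lambda$ be the unitary representation of $\mathrm{SO}(n)\times\mathrm{SO}(2)$ on $\mathcal A^2_\lambda(D)$ given by $(\pi_\lambda(A,t)f)(z)=f(\overline t A^{-1}z)$. Let $H\subset\mathrm{SO}(n)\times\mathrm{SO}(2)$ be a closed subgroup such that every isotypic component of $\pi_\lambda|_H$ is finite-dimensional; here, an isotypic component is the sum of all irreducible $H$-invariant closed subspaces of $\mathcal A^2_\lambda(D)$ that are unitarily equivalent, as representations of $H$, to a given one. Then the following conditions are equivalent. 1. $\pi_\lambda|_H$ is multiplicity-free,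 i.e. every isotypic component of $\pi_\lambda|_H$ is irreducible. 2. The von Neumann algebra $\mathrm{End}_H(\mathcal A^2_\lambda(D))$ of all bounded operators on $\mathcal A^2_\lambda(D)$ that commute with $\pi_\lambda(h)$ for every $h\in H$ is commutative. 3. The unital $C^*$-algebra of operators on $\mathcal A^2_\lambda(D)$ generated by the Toeplitz operators $T_a f=B_\lambda(af)$, where $a$ runs over the symbols in $L^\infty(D)$ with $a\circ h^{-1}=a$ almost everywhere for every $h\in H$, is commutative. Here $B_\lambda:L^2(D,v_\lambda)\to\mathcal A^2_\lambda(D)$ is the orthogonal projection. -/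

import Mathlib

noncomputable section

open MeasureTheory Matrix Set Filter Topology
open scoped ENNReal

namespace UnitaryRep

variable {G : Type*} [Group G] {E : Type*} [NormedAddCommGroup E] [InnerProductSpace ℂ E]

/-- An invariant subspace of a unitary representation: a closed subspace stable under all group
elements. -/
def IsInvariant (π : G →* (E ≃ₗᵢ[ℂ] E)) (V : Submodule ℂ E) : Prop :=
  IsClosed (V : Set E) ∧ ∀ g, ∀ v ∈ V, π g v ∈ V

/-- An irreducible subspace: a nonzero invariant (closed) subspace whose only invariant (closed)
subspaces are zero and itself. -/
def IsIrreducible (π : G →* (E ≃ₗᵢ[ℂ] E)) (V : Submodule ℂ E) : Prop :=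
  IsInvariant π V ∧ V ≠ ⊥ ∧ ∀ W : Submodule ℂ E, W ≤ V → IsInvariant π W → W = ⊥ ∨ W = V

/-- Two invariant subspaces are isomorphic if there is a unitary map from one onto the other that
intertwines the group action. -/
def AreIsomorphic (π : G →* (E ≃ₗᵢ[ℂ] E)) (V W : Submodule ℂ E) : Prop :=
  ∃ U : V ≃ₗᵢ[ℂ] W, ∀ (g : G) (v v' : V), (v' : E) = π g v → (U v' : E) = π g (U v)

/-- The sum of all irreducible subspaces isomorphic to `V`. -/
def isotypicSum (π : G →* (E ≃ₗᵢ[ℂ] E)) (V : Submodule ℂ E) : Submodule ℂ E :=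
  sSup {W | IsIrreducible π W ∧ AreIsomorphic π V W}

/-- The isotypic components: for each irreducible `V`, the sum of all irreducible subspaces
isomorphic to `V`. -/
def IsIsotypicComponent (π : G →* (E ≃ₗᵢ[ℂ] E)) (C : Submodule ℂ E) : Prop :=
  ∃ V, IsIrreducible π V ∧ C = isotypicSum π V

/-- A unitary representation is multiplicity-free if every isotypic component is irreducible. -/
def IsMultiplicityFree (π : G →* (E ≃ₗᵢ[ℂ] E)) : Prop :=
  ∀ C, IsIsotypicComponent π C → IsIrreducible π C

/-- The unitary operator of a group element as a bounded operator. -/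
def op (π : G →* (E ≃ₗᵢ[ℂ] E)) (g : G) : E →L[ℂ] E :=
  ((π g : E ≃L[ℂ] E) : E →L[ℂ] E)

variable [CompleteSpace E]

theorem op_adjoint (π : G →* (E ≃ₗᵢ[ℂ] E)) (g : G) : star (op π g) = op π g⁻¹ := by
  rw [ContinuousLinearMap.star_eq_adjoint, op, op, map_inv]
  exact LinearIsometryEquiv.adjoint_eq_symm (π g)

/-- The von Neumann algebra of all bounded operators commuting with the representation. -/
def intertwiners (π : G →* (E ≃ₗᵢ[ℂ] E)) : VonNeumannAlgebra E where
  carrier := {T | ∀ g, T * op π g = op π g * T}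
  mul_mem' {a b} ha hb g := by rw [mul_assoc, hb, ← mul_assoc, ha, mul_assoc]
  add_mem' {a b} ha hb g := by rw [add_mul, mul_add, ha, hb]
  algebraMap_mem' r g := Algebra.commutes r _
  star_mem' {a} ha g := by
    have := congrArg star (ha g⁻¹)
    rw [star_mul, star_mul, op_adjoint, inv_inv] at this
    exact this.symm
  centralizer_centralizer' := by
    have : {T | ∀ g, T * op π g = op π g * T} = Set.centralizer (Set.range (op π)) := by
      ext T
      simp [Set.mem_centralizer_iff, eq_comm]
    change Set.centralizer (Set.centralizer {T | ∀ g, T * op π g = op π g * T})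
      = {T | ∀ g, T * op π g = op π g * T}
    rw [this, Set.centralizer_centralizer_centralizer]

/-- The unital C*-algebra of operators generated by `s`: the norm closure of the unital
star-algebra generated by `s`. -/
def cstarAlgebra (s : Set (E →L[ℂ] E)) : StarSubalgebra ℂ (E →L[ℂ] E) :=
  (StarAlgebra.adjoin ℂ s).topologicalClosure

end UnitaryRep

namespace CartanIV

/-- The square of the Euclidean norm `|z|` on `ℂⁿ`. (The norm that Mathlib puts on `Fin n → ℂ` is
the sup norm, so the Euclidean one is written out.) -/
def normSq {n : ℕ} (z : Fin n → ℂ) : ℝ := ∑ i, ‖z i‖ ^ 2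

/-- The Cartan domain of type IV: `|z| < 1` and `2|z|² < 1 + |zᵀz|²`. -/
def domain (n : ℕ) : Set (Fin n → ℂ) :=
  {z | √(normSq z) < 1 ∧ 2 * normSq z < 1 + ‖z ⬝ᵥ z‖ ^ 2}

/-- `Δ(z) = 1 - 2|z|² + |zᵀz|²`. -/
def Delta {n : ℕ} (z : Fin n → ℂ) : ℝ := 1 - 2 * normSq z + ‖z ⬝ᵥ z‖ ^ 2

/-- The measure on the domain with density `Δ(z)^(λ-n)` with respect to Lebesgue measure. -/
def weight (n : ℕ) (lam : ℝ) : Measure (Fin n → ℂ) :=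
  (volume.restrict (domain n)).withDensity fun z => ENNReal.ofReal (Delta z ^ (lam - n))

/-- The weighted probability measure `v_λ`: the measure with density `Δ^(λ-n)` on the domain, divided
by its total mass, which is finite exactly for `λ > n - 1`. Normalizing Lebesgue measure beforehand
would not change it. -/
def vlam (n : ℕ) (lam : ℝ) : Measure (Fin n → ℂ) :=
  (weight n lam Set.univ)⁻¹ • weight n lam

/-- The group `SO(n) × SO(2)`, where `SO(2)` is identified with the unit circle in `ℂ`. -/
abbrev SOxSO2 (n : ℕ) : Type := Matrix.specialOrthogonalGroup (Fin n) ℝ × Circle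

/-- The action `(A, t) · z = tAz` on `ℂⁿ`. -/
def act {n : ℕ} (g : SOxSO2 n) (z : Fin n → ℂ) : Fin n → ℂ :=
  (g.2 : ℂ) • ((g.1 : Matrix (Fin n) (Fin n) ℝ).map Complex.ofReal *ᵥ z)

variable {n : ℕ}

theorem act_one (z : Fin n → ℂ) : act 1 z = z := by
  simp [act, Matrix.map_one]

theorem act_mul (g h : SOxSO2 n) (z : Fin n → ℂ) : act (g * h) z = act g (act h z) := by
  have : ((g.1 : Matrix (Fin n) (Fin n) ℝ) * (h.1 : Matrix (Fin n) (Fin n) ℝ)).map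
      Complex.ofReal = (g.1 : Matrix (Fin n) (Fin n) ℝ).map Complex.ofReal *
        (h.1 : Matrix (Fin n) (Fin n) ℝ).map Complex.ofReal :=
    Matrix.map_mul (f := Complex.ofRealHom)
  simp only [act, Prod.fst_mul, Prod.snd_mul, Submonoid.coe_mul, Circle.coe_mul, this,
    Matrix.mulVec_smul, Matrix.mulVec_mulVec, smul_smul]

/-- The same action as a complex-linear map. -/
def actL (g : SOxSO2 n) : (Fin n → ℂ) →ₗ[ℂ] (Fin n → ℂ) :=
  (g.2 : ℂ) • Matrix.toLin' ((g.1 : Matrix (Fin n) (Fin n) ℝ).map Complex.ofReal)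

theorem actL_apply (g : SOxSO2 n) (z : Fin n → ℂ) : actL g z = act g z := by
  simp [actL, act]

theorem continuous_act (g : SOxSO2 n) : Continuous (act g) := by
  unfold act
  fun_prop

theorem differentiable_act (g : SOxSO2 n) : Differentiable ℂ (act g) := by
  have : act g = LinearMap.toContinuousLinearMap (actL g) := by
    ext z
    simp [actL_apply]
  rw [this]
  exact ContinuousLinearMap.differentiable _

theorem map_transpose_mul (A : Matrix.specialOrthogonalGroup (Fin n) ℝ) :
    ((A : Matrix (Fin n) (Fin n) ℝ).map Complex.ofReal)ᵀ *
      (A : Matrix (Fin n) (Fin n) ℝ).map Complex.ofReal = 1 := by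
  have h := (Matrix.mem_orthogonalGroup_iff' (Fin n) ℝ).1
    (Matrix.mem_specialOrthogonalGroup_iff.1 A.2).1
  have h2 := congrArg (fun M : Matrix (Fin n) (Fin n) ℝ => M.map Complex.ofRealHom) h
  simp only [Matrix.map_mul] at h2
  rw [Matrix.map_one _ (map_zero _) (map_one _)] at h2
  exact h2

theorem normSq_eq (z : Fin n → ℂ) : (normSq z : ℂ) = star z ⬝ᵥ z := by
  simp [normSq, dotProduct, ← Complex.normSq_eq_norm_sq, Complex.normSq_eq_conj_mul_self]

theorem normSq_act (g : SOxSO2 n) (z : Fin n → ℂ) : normSq (act g z) = normSq z := by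
  have : (normSq (act g z) : ℂ) = normSq z := by
    rw [normSq_eq, normSq_eq, act]
    set M := (g.1 : Matrix (Fin n) (Fin n) ℝ).map Complex.ofReal with hM
    have h1 : Mᴴ * M = 1 := by
      have : Mᴴ = Mᵀ := by ext i j; simp [hM]
      rw [this, map_transpose_mul]
    have h2 : star (g.2 : ℂ) * (g.2 : ℂ) = 1 := by
      simp [← Complex.normSq_eq_conj_mul_self]
    rw [star_smul, Matrix.star_mulVec, smul_dotProduct, dotProduct_smul, smul_smul, h2, one_smul,
      ← Matrix.dotProduct_mulVec, Matrix.mulVec_mulVec, h1, Matrix.one_mulVec]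
  exact_mod_cast this

theorem norm_dot_act (g : SOxSO2 n) (z : Fin n → ℂ) : ‖act g z ⬝ᵥ act g z‖ = ‖z ⬝ᵥ z‖ := by
  rw [act, smul_dotProduct, dotProduct_smul, norm_smul, norm_smul, Circle.norm_coe, one_mul,
    one_mul, Matrix.dotProduct_mulVec, Matrix.vecMul_mulVec, map_transpose_mul, Matrix.vecMul_one]

theorem act_mem_domain (g : SOxSO2 n) (z : Fin n → ℂ) : act g z ∈ domain n ↔ z ∈ domain n := by
  simp [domain, normSq_act, norm_dot_act]

theorem measurePreserving_act_volume (g : SOxSO2 n) :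
    MeasurePreserving (act g) (volume : Measure (Fin n → ℂ)) volume := by
  refine ⟨(continuous_act g).measurable, ?_⟩
  have hdet : ‖LinearMap.det (actL g)‖ = 1 := by
    have h1 : ‖((g.1 : Matrix (Fin n) (Fin n) ℝ).map Complex.ofReal).det‖ = 1 := by
      have h2 : (g.1 : Matrix (Fin n) (Fin n) ℝ).det = 1 :=
        (Matrix.mem_specialOrthogonalGroup_iff.1 g.1.2).2
      have : ((g.1 : Matrix (Fin n) (Fin n) ℝ).map Complex.ofReal).det =
          (((g.1 : Matrix (Fin n) (Fin n) ℝ).det : ℝ) : ℂ) :=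
        (RingHom.map_det Complex.ofRealHom _).symm
      rw [this, h2]
      simp
    rw [actL, LinearMap.det_smul, LinearMap.det_toLin', norm_mul, h1, norm_pow, Circle.norm_coe,
      one_pow, one_mul]
  have hR : LinearMap.det ((actL g).restrictScalars ℝ) = 1 := by
    rw [LinearMap.det_restrictScalars, Algebra.norm_complex_eq]
    simp [Complex.normSq_eq_norm_sq, hdet]
  have := Measure.map_linearMap_addHaar_eq_smul_addHaar (volume : Measure (Fin n → ℂ))
    (f := (actL g).restrictScalars ℝ) (by rw [hR]; exact one_ne_zero)
  rw [hR] at this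
  have h3 : ((actL g).restrictScalars ℝ : (Fin n → ℂ) → (Fin n → ℂ)) = act g := by
    ext z
    simp [actL_apply]
  rw [h3] at this
  simpa using this

theorem continuous_normSq : Continuous (normSq : (Fin n → ℂ) → ℝ) := by
  unfold normSq
  fun_prop

theorem continuous_dot : Continuous fun z : Fin n → ℂ => ‖z ⬝ᵥ z‖ ^ 2 := by
  unfold dotProduct
  fun_prop

theorem continuous_Delta : Continuous (Delta : (Fin n → ℂ) → ℝ) :=
  (continuous_const.sub (continuous_const.mul continuous_normSq)).add continuous_dot

theorem isOpen_domain : IsOpen (domain n) :=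
  (isOpen_lt (Real.continuous_sqrt.comp continuous_normSq) continuous_const).inter
    (isOpen_lt (continuous_const.mul continuous_normSq) (continuous_const.add continuous_dot))

theorem measurable_density (lam : ℝ) :
    Measurable fun z : Fin n → ℂ => ENNReal.ofReal (Delta z ^ (lam - n)) :=
  (continuous_Delta.measurable.pow_const _).ennreal_ofReal

theorem measurePreserving_act (lam : ℝ) (g : SOxSO2 n) :
    MeasurePreserving (act g) (vlam n lam) (vlam n lam) := by
  have hw : MeasurePreserving (act g) (weight n lam) (weight n lam) := by
    refine ⟨(continuous_act g).measurable, ?_⟩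
    have hr := (measurePreserving_act_volume g).restrict_preimage
      (isOpen_domain (n := n)).measurableSet
    have hpre : act g ⁻¹' domain n = domain n := by
      ext z
      exact act_mem_domain g z
    rw [hpre] at hr
    ext s hs
    rw [Measure.map_apply (continuous_act g).measurable hs, weight,
      withDensity_apply _ ((continuous_act g).measurable hs), withDensity_apply _ hs,
      ← hr.setLIntegral_comp_preimage hs (measurable_density lam)]
    simp [Delta, normSq_act, norm_dot_act]
  exact ⟨hw.measurable, by rw [vlam, Measure.map_smul, hw.map_eq]⟩

theorem vlam_compl (lam : ℝ) : vlam n lam (domain n)ᶜ = 0 := by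
  have : weight n lam (domain n)ᶜ = 0 := by
    refine withDensity_absolutelyContinuous _ _ ?_
    rw [Measure.restrict_apply isOpen_domain.measurableSet.compl]
    simp
  simp [vlam, this]

/-- Sub-mean value inequality on balls. -/
theorem enorm_le_lintegral_ball {g : (Fin n → ℂ) → ℂ} {c : Fin n → ℂ} {r : ℝ}
    (hg : DifferentiableOn ℂ g (Metric.ball c r)) :
    ‖g c‖ₑ * volume (Metric.ball c r) ≤ ∫⁻ z in Metric.ball c r, ‖g z‖ₑ := by
  classical
  set G : (Fin n → ℂ) → ℝ≥0∞ := (Metric.ball (0 : Fin n → ℂ) r).indicator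
    (fun w => ‖g (c + w)‖ₑ) with hG
  have hmaps : ∀ w ∈ Metric.ball (0 : Fin n → ℂ) r, c + w ∈ Metric.ball c r := by
    intro w hw
    simpa using hw
  have hcont : ContinuousOn (fun w => ‖g (c + w)‖ₑ) (Metric.ball (0 : Fin n → ℂ) r) :=
    (hg.continuousOn.comp (by fun_prop) hmaps).enorm
  have hGm : Measurable G := by
    have h := hcont.measurable_piecewise (g := fun _ => 0) continuousOn_const
      Metric.isOpen_ball.measurableSet
    rw [hG, ← Set.piecewise_eq_indicator]
    exact h
  have hI : ∫⁻ w, G w = ∫⁻ z in Metric.ball c r, ‖g z‖ₑ := by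
    rw [← lintegral_indicator Metric.isOpen_ball.measurableSet,
      ← lintegral_add_left_eq_self ((Metric.ball c r).indicator fun z => ‖g z‖ₑ) c]
    congr 1
    ext w
    by_cases hw : w ∈ Metric.ball (0 : Fin n → ℂ) r
    · rw [hG, Set.indicator_of_mem hw, Set.indicator_of_mem (hmaps w hw)]
    · rw [hG, Set.indicator_of_notMem hw, Set.indicator_of_notMem]
      simpa using hw
  have hrot : ∀ θ : ℝ, ∫⁻ w, G ((Circle.exp θ : ℂ) • w) = ∫⁻ w, G w := by
    intro θ
    have hmp := measurePreserving_act_volume ((1, Circle.exp θ) : SOxSO2 n)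
    rw [← hmp.lintegral_comp hGm]
    simp [act, Matrix.map_one]
  have hpos : (0 : ℝ) < 2 * Real.pi := by positivity
  have hmean : ∀ w ∈ Metric.ball (0 : Fin n → ℂ) r,
      ENNReal.ofReal (2 * Real.pi) * ‖g c‖ₑ ≤
        ∫⁻ θ in Set.Ioc 0 (2 * Real.pi), G ((Circle.exp θ : ℂ) • w) := by
    intro w hw
    have hmem : ∀ ζ : ℂ, ζ ∈ Metric.closedBall (0 : ℂ) 1 →
        ζ • w ∈ Metric.ball (0 : Fin n → ℂ) r := by
      intro ζ hζ
      rw [mem_ball_zero_iff, norm_smul]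
      rw [mem_closedBall_zero_iff] at hζ
      rw [mem_ball_zero_iff] at hw
      nlinarith [norm_nonneg w]
    have hd : DifferentiableOn ℂ (fun ζ : ℂ => g (c + ζ • w)) (Metric.closedBall 0 1) :=
      hg.comp (by fun_prop) fun ζ hζ => hmaps _ (hmem ζ hζ)
    have hm : Real.circleAverage (fun ζ : ℂ => g (c + ζ • w)) 0 1 = g c := by
      have := DiffContOnCl.circleAverage (f := fun ζ : ℂ => g (c + ζ • w)) (c := 0) (R := 1)
        ⟨(hd.mono (by rw [abs_one]; exact Metric.ball_subset_closedBall)),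
          hd.continuousOn.mono (by rw [abs_one]; exact Metric.closure_ball_subset_closedBall)⟩
      simpa using this
    have hint : (2 * Real.pi : ℂ) * g c =
        ∫ θ in Set.Ioc 0 (2 * Real.pi), g (c + (Circle.exp θ : ℂ) • w) := by
      rw [← intervalIntegral.integral_of_le hpos.le, ← hm, Real.circleAverage]
      simp only [circleMap, Circle.coe_exp, Complex.ofReal_one, one_mul, zero_add]
      rw [Complex.real_smul]
      push_cast
      rw [← mul_assoc, mul_inv_cancel₀ (by exact_mod_cast hpos.ne'), one_mul]
    calc ENNReal.ofReal (2 * Real.pi) * ‖g c‖ₑ = ‖(2 * Real.pi : ℂ) * g c‖ₑ := by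
          rw [enorm_mul]
          congr 1
          rw [← Real.enorm_of_nonneg hpos.le]
          simp [enorm_eq_nnnorm]
      _ ≤ ∫⁻ θ in Set.Ioc 0 (2 * Real.pi), ‖g (c + (Circle.exp θ : ℂ) • w)‖ₑ := by
          rw [hint]
          exact enorm_integral_le_lintegral_enorm _
      _ = _ := by
          refine lintegral_congr fun θ => ?_
          rw [hG, Set.indicator_of_mem (hmem _ (by simp))]
  have hmeas : Measurable fun p : (Fin n → ℂ) × ℝ => G ((Circle.exp p.2 : ℂ) • p.1) := by
    refine hGm.comp (Continuous.measurable ?_)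
    fun_prop
  have hswap : ∫⁻ w, ∫⁻ θ in Set.Ioc 0 (2 * Real.pi), G ((Circle.exp θ : ℂ) • w) =
      ENNReal.ofReal (2 * Real.pi) * ∫⁻ w, G w := by
    rw [lintegral_lintegral_swap hmeas.aemeasurable]
    simp only [hrot, lintegral_const, Measure.restrict_apply_univ, Real.volume_Ioc, sub_zero]
    rw [mul_comm]
  have hvol : volume (Metric.ball c r) = volume (Metric.ball (0 : Fin n → ℂ) r) :=
    Measure.addHaar_ball_center _ _ _
  have hle : ENNReal.ofReal (2 * Real.pi) * (‖g c‖ₑ * volume (Metric.ball c r)) ≤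
      ENNReal.ofReal (2 * Real.pi) * ∫⁻ w, G w := by
    rw [← hswap, ← mul_assoc, hvol, ← setLIntegral_const]
    exact (setLIntegral_mono' Metric.isOpen_ball.measurableSet hmean).trans
      (setLIntegral_le_lintegral _ _)
  rw [← hI]
  exact (ENNReal.mul_le_mul_iff_right (by simp [Real.pi_pos]) ENNReal.ofReal_ne_top).1 hle

theorem exists_holomorphic_limit {D : Set (Fin n → ℂ)} {g : ℕ → (Fin n → ℂ) → ℂ}
    (hg : ∀ k, DifferentiableOn ℂ (g k) D)
    (hc : ∀ c ∈ D, ∃ r > 0, Metric.ball c r ⊆ D ∧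
      UniformCauchySeqOn g atTop (Metric.ball c r)) :
    ∃ h : (Fin n → ℂ) → ℂ, DifferentiableOn ℂ h D ∧
      ∀ z ∈ D, Tendsto (fun k => g k z) atTop (𝓝 (h z)) := by
  have hlim : ∀ z ∈ D, ∃ l, Tendsto (fun k => g k z) atTop (𝓝 l) := by
    intro z hz
    obtain ⟨r, hr, -, hu⟩ := hc z hz
    exact cauchySeq_tendsto_of_complete (hu.cauchySeq (Metric.mem_ball_self hr))
  choose! h hh using hlim
  refine ⟨h, fun c hcD => ?_, hh⟩
  obtain ⟨r, hr, hsub, hu⟩ := hc c hcD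
  have hdiff : ∀ k, ∀ z ∈ Metric.ball c r, DifferentiableAt ℂ (g k) z := fun k z hz =>
    ((hg k).mono hsub).differentiableAt (Metric.isOpen_ball.mem_nhds hz)
  have hder : UniformCauchySeqOn (fun k => fderiv ℂ (g k)) atTop (Metric.ball c (r / 2)) := by
    rw [Metric.uniformCauchySeqOn_iff] at hu ⊢
    intro ε hε
    obtain ⟨N, hN⟩ := hu (ε / 2 * (r / 4)) (by positivity)
    refine ⟨N, fun k hk m hm z hz => ?_⟩
    have hball : ∀ u : Fin n → ℂ, ‖u‖ ≤ r / 4 → z + u ∈ Metric.ball c r := by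
      intro u hu'
      rw [Metric.mem_ball, dist_eq_norm] at hz ⊢
      calc ‖z + u - c‖ = ‖(z - c) + u‖ := by congr 1; abel
        _ ≤ ‖z - c‖ + ‖u‖ := norm_add_le _ _
        _ < r := by linarith
    have hzr : z ∈ Metric.ball c r := Metric.ball_subset_ball (by linarith) hz
    suffices hs : ‖fderiv ℂ (g k) z - fderiv ℂ (g m) z‖ ≤ ε / 2 by
      rw [dist_eq_norm]; linarith
    refine ContinuousLinearMap.opNorm_le_bound _ (by positivity) fun v => ?_
    by_cases hv : v = 0
    · simp [hv]
    have hvn : 0 < ‖v‖ := norm_pos_iff.2 hv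
    set R := r / 4 / ‖v‖ with hR
    have hR0 : 0 < R := by positivity
    have hmem : ∀ ζ : ℂ, ζ ∈ Metric.closedBall (0 : ℂ) R → z + ζ • v ∈ Metric.ball c r := by
      intro ζ hζ
      refine hball _ ?_
      rw [norm_smul]
      rw [mem_closedBall_zero_iff, hR, le_div_iff₀ hvn] at hζ
      exact hζ
    have hline : ∀ k, ∀ ζ ∈ Metric.closedBall (0 : ℂ) R,
        HasDerivAt (fun ζ : ℂ => g k (z + ζ • v)) (fderiv ℂ (g k) (z + ζ • v) v) ζ := by
      intro k ζ hζ
      have h1 : HasDerivAt (fun ζ : ℂ => z + ζ • v) v ζ := by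
        simpa using ((hasDerivAt_id ζ).smul_const v).const_add z
      exact (hdiff k _ (hmem ζ hζ)).hasFDerivAt.comp_hasDerivAt ζ h1
    have h0 : (0 : ℂ) ∈ Metric.closedBall (0 : ℂ) R := by simp [hR0.le]
    have hd0 := ((hline k 0 h0).sub (hline m 0 h0)).deriv
    simp only [zero_smul, add_zero] at hd0
    rw [_root_.sub_apply, ← hd0]
    have hdc : DiffContOnCl ℂ
        ((fun ζ : ℂ => g k (z + ζ • v)) - fun ζ : ℂ => g m (z + ζ • v)) (Metric.ball 0 R) := by
      have hall : DifferentiableOn ℂ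
          ((fun ζ : ℂ => g k (z + ζ • v)) - fun ζ : ℂ => g m (z + ζ • v))
          (Metric.closedBall 0 R) := fun ζ hζ =>
        ((hline k ζ hζ).sub (hline m ζ hζ)).differentiableAt.differentiableWithinAt
      exact ⟨hall.mono Metric.ball_subset_closedBall,
        hall.continuousOn.mono Metric.closure_ball_subset_closedBall⟩
    refine (Complex.norm_deriv_le_of_forall_mem_sphere_norm_le hR0 hdc
      (C := ε / 2 * (r / 4)) fun ζ hζ => ?_).trans (le_of_eq ?_)
    · have := hN k hk m hm _ (hmem ζ (Metric.sphere_subset_closedBall hζ))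
      rw [dist_eq_norm] at this
      exact this.le
    · rw [hR]
      field_simp
  have hlim' : ∀ z ∈ Metric.ball c (r / 2), ∃ l,
      Tendsto (fun k => fderiv ℂ (g k) z) atTop (𝓝 l) := fun z hz =>
    cauchySeq_tendsto_of_complete (hder.cauchySeq hz)
  choose! h' hh' using hlim'
  have hsub2 : Metric.ball c (r / 2) ⊆ Metric.ball c r := Metric.ball_subset_ball (by linarith)
  exact (hasFDerivAt_of_tendstoUniformlyOn Metric.isOpen_ball
    (hder.tendstoUniformlyOn_of_tendsto hh')
    (fun k z hz => (hdiff k z (hsub2 hz)).hasFDerivAt)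
    (fun z hz => hh z (hsub (hsub2 hz)))
    (Metric.mem_ball_self (by positivity))).differentiableAt.differentiableWithinAt

theorem Delta_pos {z : Fin n → ℂ} (hz : z ∈ domain n) : 0 < Delta z := by
  have := hz.2
  unfold Delta
  linarith

/-- Local point evaluation estimate for holomorphic functions in the weighted norm. -/
theorem exists_eval_bound {lam : ℝ} (h0 : weight n lam Set.univ ≠ 0)
    (htop : weight n lam Set.univ ≠ ∞) {c : Fin n → ℂ} (hc : c ∈ domain n) :
    ∃ r > 0, Metric.ball c r ⊆ domain n ∧ ∃ C : ℝ≥0∞, C ≠ ∞ ∧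
      ∀ g : (Fin n → ℂ) → ℂ, DifferentiableOn ℂ g (domain n) → ∀ z ∈ Metric.ball c r,
        ‖g z‖ₑ ^ 2 ≤ C * ∫⁻ w, ‖g w‖ₑ ^ 2 ∂(vlam n lam) := by
  set δ : ℝ := Delta c ^ (lam - n) / 2 with hδ
  have hδ0 : 0 < δ := by
    have := Real.rpow_pos_of_pos (Delta_pos hc) (lam - n)
    positivity
  have hev : ∀ᶠ z in 𝓝 c, z ∈ domain n ∧ δ < Delta z ^ (lam - n) := by
    refine Filter.Eventually.and (isOpen_domain.mem_nhds hc) ?_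
    refine (((continuous_Delta (n := n)).continuousAt (x := c)).rpow_const
      (Or.inl (Delta_pos hc).ne')).eventually (lt_mem_nhds ?_)
    linarith
  obtain ⟨ρ, hρ, hball⟩ := Metric.eventually_nhds_iff_ball.1 hev
  have hvpos : volume (Metric.ball c (ρ / 2)) ≠ 0 :=
    (Metric.measure_ball_pos volume c (by positivity)).ne'
  have hvtop : volume (Metric.ball c (ρ / 2)) ≠ ∞ := measure_ball_lt_top.ne
  refine ⟨ρ / 2, by positivity, fun z hz =>
    (hball z (Metric.ball_subset_ball (by linarith) hz)).1,
    (volume (Metric.ball c (ρ / 2)))⁻¹ * ((ENNReal.ofReal δ)⁻¹ * weight n lam Set.univ), ?_, ?_⟩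
  · refine ENNReal.mul_ne_top (ENNReal.inv_ne_top.2 hvpos)
      (ENNReal.mul_ne_top (ENNReal.inv_ne_top.2 ?_) htop)
    simpa using hδ0
  intro g hg z hz
  have hsub : Metric.ball z (ρ / 2) ⊆ Metric.ball c ρ := by
    refine Metric.ball_subset_ball' ?_
    rw [Metric.mem_ball] at hz
    linarith
  have hsubD : Metric.ball z (ρ / 2) ⊆ domain n := fun w hw => (hball w (hsub hw)).1
  have hmv := enorm_le_lintegral_ball ((hg.mono hsubD).pow 2)
  simp only [Pi.pow_apply, enorm_pow] at hmv
  have hvol : volume (Metric.ball z (ρ / 2)) = volume (Metric.ball c (ρ / 2)) := by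
    rw [Measure.addHaar_ball_center, Measure.addHaar_ball_center _ c]
  rw [hvol] at hmv
  have hδe : ENNReal.ofReal δ ≠ 0 := by simpa using hδ0
  have hbd : ENNReal.ofReal δ * ∫⁻ w in Metric.ball z (ρ / 2), ‖g w‖ₑ ^ 2 ≤
      ∫⁻ w, ‖g w‖ₑ ^ 2 ∂(weight n lam) := by
    rw [weight, lintegral_withDensity_eq_lintegral_mul_non_measurable _ (measurable_density lam)
      (by simp), ← lintegral_const_mul' _ _ ENNReal.ofReal_ne_top]
    refine (setLIntegral_mono' Metric.isOpen_ball.measurableSet fun w hw => ?_).trans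
      (lintegral_mono_set hsubD)
    simp only [Pi.mul_apply]
    gcongr
    exact (hball w (hsub hw)).2.le
  have hvl : ∫⁻ w, ‖g w‖ₑ ^ 2 ∂(weight n lam) =
      weight n lam Set.univ * ∫⁻ w, ‖g w‖ₑ ^ 2 ∂(vlam n lam) := by
    rw [vlam, lintegral_smul_measure, smul_eq_mul, ← mul_assoc,
      ENNReal.mul_inv_cancel h0 htop, one_mul]
  rw [hvl] at hbd
  rw [mul_assoc, mul_assoc, ← ENNReal.div_eq_inv_mul,
    ENNReal.le_div_iff_mul_le (Or.inl hvpos) (Or.inl hvtop), ← ENNReal.div_eq_inv_mul,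
    ENNReal.le_div_iff_mul_le (Or.inl hδe) (Or.inl ENNReal.ofReal_ne_top), mul_comm]
  exact (by gcongr : _ ≤ _).trans hbd

/-- The Hilbert space `L²(v_λ)`. -/
abbrev L2 (n : ℕ) (lam : ℝ) : Type := Lp ℂ 2 (vlam n lam)

/-- The weighted Bergman space: the classes in `L²(v_λ)` of functions holomorphic on the domain. -/
def bergman (n : ℕ) (lam : ℝ) : Submodule ℂ (L2 n lam) where
  carrier := {f | ∃ g : (Fin n → ℂ) → ℂ, DifferentiableOn ℂ g (domain n) ∧ f =ᵐ[vlam n lam] g}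
  zero_mem' := ⟨0, differentiableOn_const 0, Lp.coeFn_zero _ _ _⟩
  add_mem' := by
    rintro f₁ f₂ ⟨g₁, h₁, e₁⟩ ⟨g₂, h₂, e₂⟩
    exact ⟨g₁ + g₂, h₁.add h₂, (Lp.coeFn_add f₁ f₂).trans (e₁.add e₂)⟩
  smul_mem' := by
    rintro c f ⟨g, h, e⟩
    exact ⟨c • g, h.const_smul c, (Lp.coeFn_smul c f).trans (e.const_smul c)⟩

theorem isClosed_bergman (lam : ℝ) : IsClosed (bergman n lam : Set (L2 n lam)) := by
  by_cases hv : vlam n lam = 0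
  · have : (bergman n lam : Set (L2 n lam)) = Set.univ := by
      refine Set.eq_univ_of_forall fun f => ⟨0, differentiableOn_const 0, ?_⟩
      simp [Filter.EventuallyEq, hv]
    rw [this]
    exact isClosed_univ
  have h0 : weight n lam Set.univ ≠ 0 := fun h => hv (by
    rw [Measure.measure_univ_eq_zero] at h
    simp [vlam, h])
  have htop : weight n lam Set.univ ≠ ∞ := fun h => hv (by simp [vlam, h])
  refine isClosed_of_closure_subset fun f hf => ?_
  obtain ⟨F, hF, hlim⟩ := mem_closure_iff_seq_limit.1 hf
  choose g hg he using hF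
  have hint : ∀ k m, ∫⁻ w, ‖g k w - g m w‖ₑ ^ 2 ∂(vlam n lam) = ‖F k - F m‖ₑ ^ 2 := by
    intro k m
    have h1 := Lp.coeFn_sub (F k) (F m)
    rw [Lp.enorm_def, eLpNorm_eq_lintegral_rpow_enorm_toReal (by norm_num) (by norm_num),
      ← ENNReal.rpow_natCast, ← ENNReal.rpow_mul]
    simp only [ENNReal.toReal_ofNat, Nat.cast_ofNat, one_div]
    rw [inv_mul_cancel₀ two_ne_zero, ENNReal.rpow_one]
    refine lintegral_congr_ae ?_
    filter_upwards [h1, he k, he m] with w hw hk hm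
    rw [hw, Pi.sub_apply, hk, hm]
    norm_cast
  obtain ⟨h, hd, hh⟩ := exists_holomorphic_limit hg (D := domain n) (by
    intro c hc
    obtain ⟨r, hr, hsub, C, hC, hb⟩ := exists_eval_bound h0 htop hc
    refine ⟨r, hr, hsub, ?_⟩
    rw [Metric.uniformCauchySeqOn_iff]
    intro ε hε
    obtain ⟨N, hN⟩ := Metric.cauchySeq_iff.1 hlim.cauchySeq (ε / (√C.toReal + 1)) (by positivity)
    refine ⟨N, fun k hk m hm z hz => ?_⟩
    have h1 := hb (fun w => g k w - g m w) ((hg k).sub (hg m)) z hz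
    rw [hint, ← ENNReal.toReal_le_toReal (by simp)
      (ENNReal.mul_ne_top hC (by simp)), ENNReal.toReal_mul, ENNReal.toReal_pow,
      ENNReal.toReal_pow, toReal_enorm, toReal_enorm] at h1
    have h2 : ‖g k z - g m z‖ ≤ √C.toReal * ‖F k - F m‖ := by
      refine abs_le_of_sq_le_sq' ?_ (by positivity) |>.2
      rw [mul_pow, Real.sq_sqrt ENNReal.toReal_nonneg]
      exact h1
    have h3 := hN k hk m hm
    rw [dist_eq_norm, lt_div_iff₀ (by positivity)] at h3
    rw [dist_eq_norm]
    nlinarith [norm_nonneg (F k - F m), Real.sqrt_nonneg C.toReal])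
  refine ⟨h, hd, ?_⟩
  obtain ⟨ns, hns, hae⟩ := (tendstoInMeasure_of_tendsto_Lp hlim).exists_seq_tendsto_ae
  have hD : ∀ᵐ z ∂(vlam n lam), z ∈ domain n := vlam_compl lam
  filter_upwards [hae, hD, ae_all_iff.2 he] with z hz hzD hez
  refine tendsto_nhds_unique hz ?_
  simp only [hez]
  exact (hh z hzD).comp hns.tendsto_atTop

instance (lam : ℝ) : CompleteSpace (bergman n lam) :=
  (isClosed_bergman lam).completeSpace_coe

/-- The isometry `f ↦ f ∘ g⁻¹` of `L²(v_λ)`. -/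
def rotate (lam : ℝ) (g : SOxSO2 n) : L2 n lam →ₗᵢ[ℂ] L2 n lam :=
  Lp.compMeasurePreservingₗᵢ ℂ (act g⁻¹) (measurePreserving_act lam g⁻¹)

theorem rotate_ae (lam : ℝ) (g : SOxSO2 n) (f : L2 n lam) :
    rotate lam g f =ᵐ[vlam n lam] fun z => f (act g⁻¹ z) :=
  Lp.coeFn_compMeasurePreserving f (measurePreserving_act lam g⁻¹)

theorem rotate_one (lam : ℝ) (f : L2 n lam) : rotate lam 1 f = f := by
  refine Lp.ext ((rotate_ae lam 1 f).trans ?_)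
  simp [act_one]

theorem rotate_mul (lam : ℝ) (g h : SOxSO2 n) (f : L2 n lam) :
    rotate lam (g * h) f = rotate lam g (rotate lam h f) := by
  refine Lp.ext ((rotate_ae lam _ f).trans ?_)
  refine EventuallyEq.symm ((rotate_ae lam g _).trans ?_)
  have := (measurePreserving_act lam g⁻¹).quasiMeasurePreserving.ae_eq_comp (rotate_ae lam h f)
  refine this.trans (Eventually.of_forall fun z => ?_)
  simp [act_mul]

theorem rotate_mem (lam : ℝ) (g : SOxSO2 n) {f : L2 n lam} (hf : f ∈ bergman n lam) :
    rotate lam g f ∈ bergman n lam := by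
  obtain ⟨u, hu, he⟩ := hf
  refine ⟨u ∘ act g⁻¹, hu.comp (differentiable_act g⁻¹).differentiableOn
    fun z hz => (act_mem_domain _ z).2 hz, (rotate_ae lam g f).trans ?_⟩
  exact (measurePreserving_act lam g⁻¹).quasiMeasurePreserving.ae_eq_comp he

/-- The unitary representation `(π_λ(A, t) f)(z) = f(t⁻¹A⁻¹z)` on the weighted Bergman space. -/
def piLam (n : ℕ) (lam : ℝ) : SOxSO2 n →* (bergman n lam ≃ₗᵢ[ℂ] bergman n lam) where
  toFun g :=
    { toFun := fun f => ⟨rotate lam g f, rotate_mem lam g f.2⟩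
      invFun := fun f => ⟨rotate lam g⁻¹ f, rotate_mem lam g⁻¹ f.2⟩
      left_inv := fun f => Subtype.ext (by
        dsimp only; rw [← rotate_mul, inv_mul_cancel, rotate_one])
      right_inv := fun f => Subtype.ext (by
        dsimp only; rw [← rotate_mul, mul_inv_cancel, rotate_one])
      map_add' := fun f₁ f₂ => Subtype.ext (map_add (rotate lam g) _ _)
      map_smul' := fun c f => Subtype.ext (map_smul (rotate lam g) c _)
      norm_map' := fun f => (rotate lam g).norm_map f }
  map_one' := by
    refine LinearIsometryEquiv.ext fun f => ?_
    exact Subtype.ext (rotate_one lam (f : L2 n lam))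
  map_mul' g h := by
    refine LinearIsometryEquiv.ext fun f => ?_
    exact Subtype.ext (rotate_mul lam g h (f : L2 n lam))

/-- The space of symbols. For `λ > n - 1` the measure `v_λ` and Lebesgue measure on the domain have the
same null sets, so that this is the usual `L^∞` of the domain. -/
abbrev Linfty (n : ℕ) (lam : ℝ) : Type := Lp ℂ ∞ (vlam n lam)

/-- The multiplication operator `M_a f = a f` on `L²(v_λ)`; see `mulOp_ae`. -/
def mulOp (lam : ℝ) (a : Linfty n lam) : L2 n lam →L[ℂ] L2 n lam :=
  (ContinuousLinearMap.mul ℂ ℂ).holderL (vlam n lam) ∞ 2 2 a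

theorem mulOp_ae (lam : ℝ) (a : Linfty n lam) (f : L2 n lam) :
    mulOp lam a f =ᵐ[vlam n lam] fun z => a z * f z :=
  (ContinuousLinearMap.mul ℂ ℂ).coeFn_holder a f

/-- The Toeplitz operator `T_a f = B_λ(a f)`, with `B_λ` the orthogonal projection of `L²(v_λ)` onto the
Bergman space. -/
def toeplitz (lam : ℝ) (a : Linfty n lam) : bergman n lam →L[ℂ] bergman n lam :=
  (bergman n lam).orthogonalProjectionOnto ∘L mulOp lam a ∘L (bergman n lam).subtypeL

/-- The symbols fixed by `a ↦ a ∘ h⁻¹` for all `h ∈ H`. -/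
def invariantSymbols (lam : ℝ) (H : Subgroup (SOxSO2 n)) : Submodule ℂ (Linfty n lam) where
  carrier := {a | ∀ h ∈ H,
    Lp.compMeasurePreservingₗ ℂ (act h⁻¹) (measurePreserving_act lam h⁻¹) a = a}
  zero_mem' h _ := map_zero _
  add_mem' ha hb h hh := by rw [map_add, ha h hh, hb h hh]
  smul_mem' c a ha h hh := by rw [map_smul, ha h hh]

/-- The unital C*-algebra generated by the Toeplitz operators with symbols in `S`. When `S` is closed
under complex conjugation, as it is for invariant symbols, this is also the unital Banach algebra
generated by them. -/
def toeplitzAlgebra (lam : ℝ) (S : Set (Linfty n lam)) :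
    StarSubalgebra ℂ (bergman n lam →L[ℂ] bergman n lam) :=
  UnitaryRep.cstarAlgebra (toeplitz lam '' S)

end CartanIV

end

/-! Toeplitz operators with invariant symbols intertwine the action of `H`. The intertwiners form a
norm-closed star-algebra, so they contain the C*-algebra generated by these operators, and 2 implies
3.

For 1 ⇒ 2, restriction to a small Euclidean ball is an injective compact operator J into L² of that
ball (Montel). Both the ball and the measure are invariant, so J*J commutes with the group; its
eigenspaces for nonzero eigenvalues are finite-dimensional, invariant and span a dense subspace
(`orthogonal_sSup_invariant_eq_bot`). Hence the irreducible subspaces span a dense subspace.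
Multiplicity-freeness makes each of them its own isotypic component; intertwiners preserve it and
act on it by scalars (Schur), so they commute.

For 3 ⇒ 1, let C be a finite-dimensional invariant subspace with reproducing kernel k. For S
commuting with `H` on C, the trace of S times the compressed T_a is the integral of a(z)⟨k_z, S k_z⟩
(`trace_mul_compress`). The diagonal ⟨k_z, S k_z⟩ is itself `H`-invariant, so if all these traces
vanish, a symbol built from its conjugate shows that it vanishes; polarization then gives S = 0. By
duality every element of the commutant of C is a compressed Toeplitz operator
(`exists_compress_toeplitz_eq`). On an isotypic component, commuting Toeplitz operators therefore
force all intertwiners to commute, which leaves room for only one irreducible summand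
(`isIrreducible_isotypicSum`). -/

noncomputable section

open MeasureTheory Matrix Set Filter Topology
open scoped ENNReal

/-! ### Invariant subspaces, irreducibility and Schur's lemma. -/

namespace UnitaryRep

variable {G : Type*} [Group G] {E : Type*} [NormedAddCommGroup E] [InnerProductSpace ℂ E]

theorem inner_apply_left (π : G →* (E ≃ₗᵢ[ℂ] E)) (g : G) (u v : E) :
    inner ℂ (π g u) v = inner ℂ u (π g⁻¹ v) := by
  rw [← (π g).inner_map_map u (π g⁻¹ v)]
  congr 1
  change v = (π g * π g⁻¹) v
  rw [← map_mul, mul_inv_cancel, map_one]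
  rfl

theorem IsInvariant.orthogonal {π : G →* (E ≃ₗᵢ[ℂ] E)} {V : Submodule ℂ E}
    (hV : IsInvariant π V) : IsInvariant π Vᗮ := by
  refine ⟨V.isClosed_orthogonal, fun g v hv u hu => ?_⟩
  have h := inner_apply_left π g⁻¹ u v
  rw [inv_inv] at h
  rw [← h]
  exact hv _ (hV.2 g⁻¹ u hu)

theorem IsInvariant.inf {π : G →* (E ≃ₗᵢ[ℂ] E)} {V W : Submodule ℂ E}
    (hV : IsInvariant π V) (hW : IsInvariant π W) : IsInvariant π (V ⊓ W) :=
  ⟨hV.1.inter hW.1, fun g v hv => ⟨hV.2 g v hv.1, hW.2 g v hv.2⟩⟩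

theorem isInvariant_of_finiteDimensional (π : G →* (E ≃ₗᵢ[ℂ] E)) (V : Submodule ℂ E)
    [FiniteDimensional ℂ V] (h : ∀ g, ∀ v ∈ V, π g v ∈ V) : IsInvariant π V :=
  ⟨V.closed_of_finiteDimensional, h⟩

theorem sSup_stable (π : G →* (E ≃ₗᵢ[ℂ] E)) {s : Set (Submodule ℂ E)}
    (hs : ∀ W ∈ s, ∀ g, ∀ v ∈ W, π g v ∈ W) (g : G) (v : E) (hv : v ∈ sSup s) :
    π g v ∈ sSup s := by
  have : sSup s ≤ (sSup s).comap (π g).toLinearEquiv.toLinearMap :=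
    sSup_le fun W hW w hw => (le_sSup hW : W ≤ sSup s) (hs W hW g w hw)
  exact this hv

theorem IsInvariant.starProjection_apply {π : G →* (E ≃ₗᵢ[ℂ] E)} {V : Submodule ℂ E}
    [V.HasOrthogonalProjection] (hV : IsInvariant π V) (g : G) (v : E) :
    V.starProjection (π g v) = π g (V.starProjection v) := by
  refine Submodule.eq_starProjection_of_mem_orthogonal
    (hV.2 g _ (Submodule.starProjection_apply_mem V v)) ?_
  rw [← map_sub]
  exact hV.orthogonal.2 g _ (Submodule.sub_starProjection_mem_orthogonal v)

/-- A nonzero finite-dimensional invariant subspace contains an irreducible one. -/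
theorem exists_isIrreducible_le {π : G →* (E ≃ₗᵢ[ℂ] E)} (F : Submodule ℂ E)
    [FiniteDimensional ℂ F] (hF : IsInvariant π F) (hne : F ≠ ⊥) :
    ∃ V ≤ F, IsIrreducible π V := by
  by_cases hirr : IsIrreducible π F
  · exact ⟨F, le_rfl, hirr⟩
  · have : ∃ W ≤ F, IsInvariant π W ∧ W ≠ ⊥ ∧ W ≠ F := by
      by_contra! h
      exact hirr ⟨hF, hne, fun W hW hi => or_iff_not_imp_left.2 fun h0 => h W hW hi h0⟩
    obtain ⟨W, hW, hi, h0, hne'⟩ := this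
    have hlt : Module.finrank ℂ W < Module.finrank ℂ F :=
      Submodule.finrank_lt_finrank_of_lt (lt_of_le_of_ne hW hne')
    have := Submodule.finiteDimensional_of_le hW
    obtain ⟨V, hV, hVi⟩ := exists_isIrreducible_le W hi h0
    exact ⟨V, hV.trans hW, hVi⟩
termination_by Module.finrank ℂ F

/-- A finite-dimensional invariant subspace is contained in the sum of all irreducible ones. -/
theorem le_sSup_isIrreducible {π : G →* (E ≃ₗᵢ[ℂ] E)} (F : Submodule ℂ E)
    [FiniteDimensional ℂ F] (hF : IsInvariant π F) : F ≤ sSup {V | IsIrreducible π V} := by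
  set N : Submodule ℂ E := sSup {V | IsIrreducible π V ∧ V ≤ F} with hN
  have hNF : N ≤ F := sSup_le fun V hV => hV.2
  have : FiniteDimensional ℂ N := Submodule.finiteDimensional_of_le hNF
  have hNi : IsInvariant π N := isInvariant_of_finiteDimensional π N
    (sSup_stable π fun W hW => hW.1.1.2)
  have hbot : Nᗮ ⊓ F = ⊥ := by
    by_contra hne
    have : FiniteDimensional ℂ (Nᗮ ⊓ F : Submodule ℂ E) :=
      Submodule.finiteDimensional_of_le inf_le_right
    obtain ⟨V, hV, hVi⟩ := exists_isIrreducible_le _ (hNi.orthogonal.inf hF) hne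
    have h1 : V ≤ N := le_sSup ⟨hVi, hV.trans inf_le_right⟩
    refine hVi.2.1 (eq_bot_iff.2 ?_)
    rw [← N.inf_orthogonal_eq_bot]
    exact le_inf h1 (hV.trans inf_le_left)
  have := Submodule.sup_orthogonal_inf_of_hasOrthogonalProjection hNF
  rw [hbot, sup_bot_eq] at this
  rw [← this]
  exact sSup_le_sSup fun V hV => hV.1

theorem AreIsomorphic.refl (π : G →* (E ≃ₗᵢ[ℂ] E)) (V : Submodule ℂ E) : AreIsomorphic π V V :=
  ⟨LinearIsometryEquiv.refl ℂ V, fun _ _ _ h => h⟩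

theorem AreIsomorphic.trans {π : G →* (E ≃ₗᵢ[ℂ] E)} {V W X : Submodule ℂ E}
    (h₁ : AreIsomorphic π V W) (h₂ : AreIsomorphic π W X) : AreIsomorphic π V X := by
  obtain ⟨U₁, h₁⟩ := h₁
  obtain ⟨U₂, h₂⟩ := h₂
  exact ⟨U₁.trans U₂, fun g v v' h => h₂ g _ _ (h₁ g v v' h)⟩

theorem le_isotypicSum {π : G →* (E ≃ₗᵢ[ℂ] E)} {V : Submodule ℂ E} (hV : IsIrreducible π V) :
    V ≤ isotypicSum π V :=
  le_sSup ⟨hV, AreIsomorphic.refl π V⟩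

theorem isInvariant_isotypicSum (π : G →* (E ≃ₗᵢ[ℂ] E)) (V : Submodule ℂ E)
    [FiniteDimensional ℂ (isotypicSum π V)] : IsInvariant π (isotypicSum π V) :=
  isInvariant_of_finiteDimensional π _ (sSup_stable π fun _ hW => hW.1.1.2)

/-- **Schur's lemma**. -/
theorem IsIrreducible.exists_eq_smul {π : G →* (E ≃ₗᵢ[ℂ] E)} {V : Submodule ℂ E}
    [FiniteDimensional ℂ V] (hV : IsIrreducible π V) (T : E →ₗ[ℂ] E) (hTV : ∀ v ∈ V, T v ∈ V)
    (hT : ∀ g, ∀ v ∈ V, T (π g v) = π g (T v)) : ∃ c : ℂ, ∀ v ∈ V, T v = c • v := by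
  have : Nontrivial V := Submodule.nontrivial_iff_ne_bot.2 hV.2.1
  obtain ⟨c, hc⟩ := Module.End.exists_eigenvalue (T.restrict hTV)
  obtain ⟨v, hv⟩ := hc.exists_hasEigenvector
  -- The eigenspace inside V is invariant because T commutes with the action, and nonzero because it
  -- contains v.
  have hW : V ⊓ Module.End.eigenspace T c = V := by
    have : FiniteDimensional ℂ (V ⊓ Module.End.eigenspace T c : Submodule ℂ E) :=
      Submodule.finiteDimensional_of_le inf_le_left
    refine (hV.2.2 _ inf_le_left (isInvariant_of_finiteDimensional π _ ?_)).resolve_left ?_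
    · rintro g w ⟨hw, hwc⟩
      refine ⟨hV.1.2 g w hw, ?_⟩
      rw [SetLike.mem_coe, Module.End.mem_eigenspace_iff] at hwc ⊢
      rw [hT g w hw, hwc, map_smul]
    · intro h
      have hm : (v : E) ∈ V ⊓ Module.End.eigenspace T c := by
        refine ⟨v.2, ?_⟩
        rw [SetLike.mem_coe, Module.End.mem_eigenspace_iff]
        exact congrArg Subtype.val hv.apply_eq_smul
      rw [h, Submodule.mem_bot] at hm
      exact hv.2 (Subtype.ext hm)
  refine ⟨c, fun w hw => ?_⟩
  rw [← hW] at hw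
  exact Module.End.mem_eigenspace_iff.1 hw.2

/-! ### Intertwiners and isotypic components. -/

variable [CompleteSpace E]

theorem mem_intertwiners_iff {π : G →* (E ≃ₗᵢ[ℂ] E)} {T : E →L[ℂ] E} :
    T ∈ intertwiners π ↔ ∀ g v, T (π g v) = π g (T v) :=
  forall_congr' fun _ => ContinuousLinearMap.ext_iff

theorem starProjection_mem_intertwiners {π : G →* (E ≃ₗᵢ[ℂ] E)} {V : Submodule ℂ E}
    [V.HasOrthogonalProjection] (hV : IsInvariant π V) : V.starProjection ∈ intertwiners π :=
  mem_intertwiners_iff.2 hV.starProjection_apply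

/-- An intertwiner annihilates a finite-dimensional irreducible subspace or maps it onto an
isomorphic one. -/
theorem IsIrreducible.map_intertwiner {π : G →* (E ≃ₗᵢ[ℂ] E)} {V : Submodule ℂ E}
    [FiniteDimensional ℂ V] (hV : IsIrreducible π V) {T : E →L[ℂ] E} (hT : T ∈ intertwiners π) :
    V.map (T : E →ₗ[ℂ] E) = ⊥ ∨ IsIrreducible π (V.map (T : E →ₗ[ℂ] E)) ∧
      AreIsomorphic π V (V.map (T : E →ₗ[ℂ] E)) := by
  have hTg := mem_intertwiners_iff.1 hT
  -- The compression of T*T to V commutes with the action, hence is a scalar c. So ‖Tv‖² = c‖v‖² on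
  -- V, and T is there a multiple of an isometry.
  obtain ⟨c, hc⟩ := hV.exists_eq_smul
    ((V.starProjection * (star T * T) : E →L[ℂ] E) : E →ₗ[ℂ] E)
    (fun v _ => Submodule.starProjection_apply_mem V _) fun g v _ =>
      mem_intertwiners_iff.1 (mul_mem (starProjection_mem_intertwiners hV.1)
        (mul_mem (star_mem hT) hT)) g v
  have hinner : ∀ v ∈ V, (‖T v‖ : ℂ) ^ 2 = c * (‖v‖ : ℂ) ^ 2 := by
    intro v hv
    have h1 : inner ℂ v (V.starProjection (star T (T v))) = c * (‖v‖ : ℂ) ^ 2 := by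
      have : V.starProjection (star T (T v)) = c • v := hc v hv
      rw [this, inner_smul_right, inner_self_eq_norm_sq_to_K]
      rfl
    rw [← Submodule.inner_starProjection_left_eq_right,
      Submodule.starProjection_eq_self_iff.2 hv, ContinuousLinearMap.star_eq_adjoint,
      ContinuousLinearMap.adjoint_inner_right, inner_self_eq_norm_sq_to_K] at h1
    exact h1
  have hre : ∀ v ∈ V, ‖T v‖ ^ 2 = c.re * ‖v‖ ^ 2 := by
    intro v hv
    have := congrArg Complex.re (hinner v hv)
    norm_cast at this
    rwa [Complex.re_mul_ofReal] at this
  rcases eq_or_ne c.re 0 with h0 | h0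
  · left
    rw [Submodule.eq_bot_iff]
    rintro _ ⟨v, hv, rfl⟩
    have := hre v hv
    rw [h0, zero_mul] at this
    simpa using this
  · right
    have hpos : 0 < c.re := by
      obtain ⟨v, hv, hv0⟩ := V.ne_bot_iff.1 hV.2.1
      have h1 := hre v hv
      have h2 : 0 < ‖v‖ ^ 2 := by positivity
      refine lt_of_le_of_ne ?_ h0.symm
      by_contra! h
      nlinarith [sq_nonneg ‖T v‖]
    have hinj : ∀ v ∈ V, T v = 0 → v = 0 := by
      intro v hv h
      have := hre v hv
      rw [h] at this
      simpa [h0] using this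
    refine ⟨⟨isInvariant_of_finiteDimensional π _ ?_, ?_, ?_⟩, ?_⟩
    · rintro g _ ⟨v, hv, rfl⟩
      exact ⟨π g v, hV.1.2 g v hv, hTg g v⟩
    · intro h
      refine hV.2.1 ((Submodule.eq_bot_iff _).2 fun v hv => hinj v hv ?_)
      exact (Submodule.eq_bot_iff _).1 h _ ⟨v, hv, rfl⟩
    · intro W hW hWi
      have : FiniteDimensional ℂ (V ⊓ W.comap (T : E →ₗ[ℂ] E) : Submodule ℂ E) :=
        Submodule.finiteDimensional_of_le inf_le_left
      have hinv : IsInvariant π (V ⊓ W.comap (T : E →ₗ[ℂ] E)) := by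
        refine isInvariant_of_finiteDimensional π _ fun g v hv => ⟨hV.1.2 g v hv.1, ?_⟩
        have := hWi.2 g _ hv.2
        simpa [hTg] using this
      rcases hV.2.2 _ inf_le_left hinv with h | h
      · left
        rw [Submodule.eq_bot_iff]
        intro w hw
        obtain ⟨v, hv, rfl⟩ := hW hw
        have : v ∈ V ⊓ W.comap (T : E →ₗ[ℂ] E) := ⟨hv, hw⟩
        rw [h, Submodule.mem_bot] at this
        simp [this]
      · right
        refine le_antisymm hW ?_
        rintro _ ⟨v, hv, rfl⟩
        rw [← h] at hv
        exact hv.2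
    -- Dividing T by √c turns it into the unitary equivalence sought.
    · set s : ℝ := √c.re with hs
      have hs0 : 0 < s := Real.sqrt_pos.2 hpos
      let L : V →ₗ[ℂ] V.map (T : E →ₗ[ℂ] E) :=
        ((s : ℂ)⁻¹) • (T : E →ₗ[ℂ] E).restrict (fun v hv => Submodule.mem_map_of_mem hv)
      have hL : ∀ v, (L v : E) = (s : ℂ)⁻¹ • T v := fun v => rfl
      have hnorm : ∀ v, ‖L v‖ = ‖v‖ := by
        intro v
        rw [← Submodule.norm_coe, hL, norm_smul, norm_inv, Complex.norm_real,
          Real.norm_of_nonneg hs0.le, ← Submodule.norm_coe v]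
        have : ‖T v‖ = s * ‖(v : E)‖ := by
          rw [← sq_eq_sq₀ (by positivity) (by positivity), hre v v.2, mul_pow, hs,
            Real.sq_sqrt hpos.le]
        rw [this, inv_mul_cancel_left₀ hs0.ne']
      refine ⟨LinearIsometryEquiv.ofSurjective ⟨L, hnorm⟩ ?_, fun g v v' h => ?_⟩
      · rintro ⟨_, v, hv, rfl⟩
        refine ⟨(s : ℂ) • ⟨v, hv⟩, Subtype.ext ?_⟩
        have hs' : (s : ℂ) ≠ 0 := by exact_mod_cast hs0.ne'
        change (L ((s : ℂ) • ⟨v, hv⟩) : E) = T v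
        rw [hL, Submodule.coe_smul, map_smul]
        exact inv_smul_smul₀ hs' _
      · change (L v' : E) = π g (L v)
        rw [hL, hL, h, hTg, map_smul]

/-- Each irreducible summand is killed or moved to an isomorphic one, which is again a summand.
Finite dimension of the sum passes to the summands, where `IsIrreducible.map_intertwiner` applies.
-/
theorem intertwiner_mem_isotypicSum {π : G →* (E ≃ₗᵢ[ℂ] E)} {V : Submodule ℂ E}
    [FiniteDimensional ℂ (isotypicSum π V)] {T : E →L[ℂ] E} (hT : T ∈ intertwiners π) {v : E}
    (hv : v ∈ isotypicSum π V) : T v ∈ isotypicSum π V := by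
  have : isotypicSum π V ≤ (isotypicSum π V).comap (T : E →ₗ[ℂ] E) := by
    refine sSup_le fun W hW => ?_
    have hWV : W ≤ isotypicSum π V := le_sSup hW
    have : FiniteDimensional ℂ W := Submodule.finiteDimensional_of_le hWV
    rw [← Submodule.map_le_iff_le_comap]
    rcases hW.1.map_intertwiner hT with h | ⟨h₁, h₂⟩
    · rw [h]
      exact bot_le
    · exact le_sSup ⟨h₁, hW.2.trans h₂⟩
  exact this hv

/-- If the intertwiners commute on an isotypic component, then this component is irreducible. -/
theorem isIrreducible_isotypicSum {π : G →* (E ≃ₗᵢ[ℂ] E)} {V : Submodule ℂ E}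
    (hV : IsIrreducible π V)
    (hcomm : ∀ S ∈ intertwiners π, ∀ T ∈ intertwiners π, ∀ v ∈ isotypicSum π V,
      S (T v) = T (S v)) : IsIrreducible π (isotypicSum π V) := by
  have hall : ∀ W, IsIrreducible π W → AreIsomorphic π V W → W ≤ V := by
    rintro W hW ⟨U, hU⟩
    have : CompleteSpace V := hV.1.1.completeSpace_coe
    -- T extends U by zero on the orthogonal complement of V. If T commutes with the projection P
    -- onto V, then for w = Tv with v in V, Pw = PTv = TPv = w, so w lies in V.
    let T : E →L[ℂ] E := W.subtypeL ∘L (U : V →L[ℂ] W) ∘L V.orthogonalProjectionOnto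
    have hT : T ∈ intertwiners π := by
      refine mem_intertwiners_iff.2 fun g v => ?_
      exact hU g _ _ (hV.1.starProjection_apply g v)
    intro w hw
    have hTv : T (U.symm ⟨w, hw⟩) = w := by
      change (U (V.orthogonalProjectionOnto _) : E) = w
      rw [Submodule.orthogonalProjectionOnto_mem_subspace_eq_self, U.apply_symm_apply]
    have h := hcomm _ (starProjection_mem_intertwiners hV.1) T hT _
      (le_isotypicSum hV (U.symm ⟨w, hw⟩).2)
    rw [Submodule.starProjection_eq_self_iff.2 (U.symm ⟨w, hw⟩).2, hTv] at h
    rw [← h]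
    exact Submodule.starProjection_apply_mem V w
  have : isotypicSum π V = V :=
    le_antisymm (sSup_le fun W hW => hall W hW.1 hW.2) (le_isotypicSum hV)
  rwa [this]

/-- In a multiplicity-free representation whose finite-dimensional invariant subspaces span a dense
subspace, and whose irreducible subspaces are finite-dimensional, all intertwiners commute. -/
theorem IsMultiplicityFree.commute {π : G →* (E ≃ₗᵢ[ℂ] E)} (hπ : IsMultiplicityFree π)
    (hfin : ∀ C, IsIsotypicComponent π C → FiniteDimensional ℂ C)
    (hdense : (sSup {F : Submodule ℂ E | FiniteDimensional ℂ F ∧ IsInvariant π F})ᗮ = ⊥)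
    {S T : E →L[ℂ] E} (hS : S ∈ intertwiners π) (hT : T ∈ intertwiners π) : S * T = T * S := by
  have hscalar : ∀ V, IsIrreducible π V → ∀ S ∈ intertwiners π, ∃ c : ℂ, ∀ v ∈ V, S v = c • v := by
    intro V hV S hS
    have := hfin _ ⟨V, hV, rfl⟩
    have hVC := le_isotypicSum hV
    have : FiniteDimensional ℂ V := Submodule.finiteDimensional_of_le hVC
    -- The component is irreducible and contains V ≠ 0, so it equals V; thus intertwiners preserve
    -- V.
    have hC := ((hπ _ ⟨V, hV, rfl⟩).2.2 V hVC hV.1).resolve_left hV.2.1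
    refine hV.exists_eq_smul (S : E →ₗ[ℂ] E) (fun v hv => ?_)
      fun g v _ => mem_intertwiners_iff.1 hS g v
    have := intertwiner_mem_isotypicSum hS (hVC hv)
    rwa [← hC] at this
  -- The kernel of the commutator is closed, so it is everything once it contains a dense subspace.
  let M : Submodule ℂ E := LinearMap.ker ((S * T - T * S : E →L[ℂ] E) : E →ₗ[ℂ] E)
  have hM : ∀ x, x ∈ M ↔ S (T x) = T (S x) := fun x => by
    simp [M, sub_eq_zero]
  have hMc : IsClosed (M : Set E) := (S * T - T * S : E →L[ℂ] E).isClosed_ker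
  have : CompleteSpace M := hMc.completeSpace_coe
  have hirr : sSup {V | IsIrreducible π V} ≤ M := by
    refine sSup_le fun V hV v hv => ?_
    obtain ⟨a, ha⟩ := hscalar V hV S hS
    obtain ⟨b, hb⟩ := hscalar V hV T hT
    rw [hM, hb v hv, ha v hv, map_smul, map_smul, ha v hv, hb v hv, smul_comm]
  have hF : sSup {F : Submodule ℂ E | FiniteDimensional ℂ F ∧ IsInvariant π F} ≤ M :=
    sSup_le fun F hF => by
      have := hF.1
      exact (le_sSup_isIrreducible F hF.2).trans hirr
  have htop : M = ⊤ := by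
    rw [← Submodule.orthogonal_eq_bot_iff, eq_bot_iff, ← hdense]
    exact Submodule.orthogonal_le hF
  ext x
  exact (hM x).1 (htop ▸ Submodule.mem_top)

end UnitaryRep

/-! ### The domain, null sets and holomorphic representatives. -/

namespace CartanIV

variable {n : ℕ} {lam : ℝ}

/-- In the extended nonnegative reals m⁻¹m ≤ 1 for every m, including 0 and ∞. -/
instance : IsFiniteMeasure (vlam n lam) := by
  refine ⟨lt_of_le_of_lt ?_ ENNReal.one_lt_top⟩
  rw [vlam, Measure.smul_apply, smul_eq_mul]
  exact ENNReal.inv_mul_le_one _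

theorem norm_dot_le_normSq (z : Fin n → ℂ) : ‖z ⬝ᵥ z‖ ≤ normSq z := by
  refine (norm_sum_le _ _).trans (le_of_eq ?_)
  simp [normSq, pow_two]

theorem normSq_nonneg (z : Fin n → ℂ) : 0 ≤ normSq z :=
  Finset.sum_nonneg fun _ _ => by positivity

theorem normSq_smul (ζ : ℂ) (z : Fin n → ℂ) : normSq (ζ • z) = ‖ζ‖ ^ 2 * normSq z := by
  simp [normSq, Finset.mul_sum, mul_pow]

theorem norm_sq_le_normSq (z : Fin n → ℂ) : ‖z‖ ^ 2 ≤ normSq z := by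
  have h : ‖z‖ ≤ √(normSq z) := by
    refine (pi_norm_le_iff_of_nonneg (Real.sqrt_nonneg _)).2 fun i => ?_
    refine Real.le_sqrt_of_sq_le ?_
    exact Finset.single_le_sum (f := fun i => ‖z i‖ ^ 2) (fun _ _ => by positivity)
      (Finset.mem_univ i)
  calc ‖z‖ ^ 2 ≤ √(normSq z) ^ 2 := by gcongr
    _ = normSq z := Real.sq_sqrt (normSq_nonneg z)

theorem zero_mem_domain : (0 : Fin n → ℂ) ∈ domain n := by
  simp [domain, normSq]

/-- The domain is stable under multiplication by complex numbers of modulus at most one. -/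
theorem smul_mem_domain {ζ : ℂ} (hζ : ‖ζ‖ ≤ 1) {z : Fin n → ℂ} (hz : z ∈ domain n) :
    ζ • z ∈ domain n := by
  obtain ⟨h1, h2⟩ := hz
  have hle := norm_dot_le_normSq z
  have h0 := normSq_nonneg z
  rw [Real.sqrt_lt' one_pos, one_pow] at h1
  have hs0 : 0 ≤ ‖ζ‖ ^ 2 := by positivity
  have hs1 : ‖ζ‖ ^ 2 ≤ 1 := pow_le_one₀ (norm_nonneg _) hζ
  have hdot : ‖(ζ • z) ⬝ᵥ (ζ • z)‖ = ‖ζ‖ ^ 2 * ‖z ⬝ᵥ z‖ := by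
    rw [smul_dotProduct, dotProduct_smul, norm_smul, norm_smul]
    ring
  refine ⟨?_, ?_⟩
  · rw [Real.sqrt_lt' one_pos, one_pow, normSq_smul]
    nlinarith
  · rw [normSq_smul, hdot]
    set s := ‖ζ‖ ^ 2
    set b := ‖z ⬝ᵥ z‖
    have hb : b ^ 2 ≤ normSq z := by nlinarith [norm_nonneg (z ⬝ᵥ z)]
    have hsb : s * b ^ 2 ≤ 1 := by nlinarith [sq_nonneg b]
    -- Multiplying 2|z|² < 1 + b² by s leaves s + sb² ≤ 1 + s²b² to prove, which is (1 - s)(1 - sb²)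
    -- ≥ 0.
    have hprod := mul_nonneg (sub_nonneg.2 hs1) (sub_nonneg.2 hsb)
    rcases hs0.eq_or_lt with hs | hs
    · simp [← hs]
    · nlinarith [mul_pos hs (sub_pos.2 h2)]

theorem weight_univ_ne_top (hv : vlam n lam ≠ 0) : weight n lam Set.univ ≠ ∞ :=
  fun h => hv (by simp [vlam, h])

theorem weight_univ_ne_zero (hv : vlam n lam ≠ 0) : weight n lam Set.univ ≠ 0 := fun h => hv (by
  rw [Measure.measure_univ_eq_zero] at h
  simp [vlam, h])

theorem ae_mem_domain : ∀ᵐ z ∂(vlam n lam), z ∈ domain n := vlam_compl lam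

/-- The density is strictly positive on the domain, and for nonzero `vlam` the normalizing factor is
nonzero. -/
theorem ae_volume_of_ae_vlam (hv : vlam n lam ≠ 0) {p : (Fin n → ℂ) → Prop}
    (h : ∀ᵐ z ∂(vlam n lam), p z) : ∀ᵐ z ∂(volume.restrict (domain n)), p z := by
  have h1 : ∀ᵐ z ∂(weight n lam), p z := by
    rwa [vlam, Measure.ae_ennreal_smul_measure_iff
      (ENNReal.inv_ne_zero.2 (weight_univ_ne_top hv))] at h
  rw [weight, ae_withDensity_iff (measurable_density lam)] at h1
  filter_upwards [h1, ae_restrict_mem isOpen_domain.measurableSet] with z hz hzD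
  refine hz ?_
  simpa using Real.rpow_pos_of_pos (Delta_pos hzD) _

/-- Functions that are continuous on an open part of the domain and agree almost everywhere there
agree on it. -/
theorem eqOn_of_ae_eq (hv : vlam n lam ≠ 0) {U : Set (Fin n → ℂ)} (hU : IsOpen U)
    (hUD : U ⊆ domain n) {f g : (Fin n → ℂ) → ℂ} (hf : ContinuousOn f U) (hg : ContinuousOn g U)
    (h : ∀ᵐ z ∂(vlam n lam), z ∈ U → f z = g z) : EqOn f g U := by
  refine Measure.eqOn_open_of_ae_eq (μ := volume) ?_ hU hf hg
  have h1 := ae_mono (Measure.restrict_mono hUD le_rfl) (ae_volume_of_ae_vlam hv h)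
  filter_upwards [h1, ae_restrict_mem hU.measurableSet] with z hz hzU using hz hzU

/-- The holomorphic representative of an element of the Bergman space, extended by zero. -/
def holo (f : bergman n lam) : (Fin n → ℂ) → ℂ :=
  (domain n).indicator (Exists.choose f.2)

theorem differentiableOn_holo (f : bergman n lam) : DifferentiableOn ℂ (holo f) (domain n) :=
  (Exists.choose_spec f.2).1.congr fun _ hz => Set.indicator_of_mem hz _

theorem holo_of_notMem (f : bergman n lam) {z : Fin n → ℂ} (hz : z ∉ domain n) : holo f z = 0 :=
  Set.indicator_of_notMem hz _

theorem coe_ae_eq_holo (f : bergman n lam) : (f : L2 n lam) =ᵐ[vlam n lam] holo f := by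
  filter_upwards [(Exists.choose_spec f.2).2, ae_mem_domain] with z hz hzD
  rw [holo, Set.indicator_of_mem hzD]
  exact hz

/-- This removes the dependence on the choice in `holo`: almost everywhere identities become
pointwise ones, by continuity. -/
theorem holo_eq (hv : vlam n lam ≠ 0) (f : bergman n lam) {g : (Fin n → ℂ) → ℂ}
    (hg : DifferentiableOn ℂ g (domain n)) (h : (f : L2 n lam) =ᵐ[vlam n lam] g) :
    EqOn (holo f) g (domain n) := by
  refine eqOn_of_ae_eq hv isOpen_domain le_rfl (differentiableOn_holo f).continuousOn
    hg.continuousOn ?_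
  filter_upwards [h, coe_ae_eq_holo f] with z h1 h2 _
  rw [← h1, h2]

/-- Point evaluation on the Bergman space. -/
def evalAt (hv : vlam n lam ≠ 0) (z : Fin n → ℂ) : bergman n lam →ₗ[ℂ] ℂ where
  toFun f := holo f z
  map_add' f g := by
    by_cases hz : z ∈ domain n
    · refine holo_eq hv _ ((differentiableOn_holo f).add (differentiableOn_holo g)) ?_ hz
      exact (Lp.coeFn_add _ _).trans ((coe_ae_eq_holo f).add (coe_ae_eq_holo g))
    · simp [holo_of_notMem _ hz]
  map_smul' c f := by
    by_cases hz : z ∈ domain n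
    · refine holo_eq hv _ ((differentiableOn_holo f).const_smul c) ?_ hz
      exact (Lp.coeFn_smul _ _).trans ((coe_ae_eq_holo f).const_smul c)
    · simp [holo_of_notMem _ hz]

theorem holo_piLam (hv : vlam n lam ≠ 0) (g : SOxSO2 n) (f : bergman n lam) (z : Fin n → ℂ) :
    holo (piLam n lam g f) z = holo f (act g⁻¹ z) := by
  by_cases hz : z ∈ domain n
  · refine holo_eq hv _ ((differentiableOn_holo f).comp
      (differentiable_act g⁻¹).differentiableOn fun z hz => (act_mem_domain _ z).2 hz) ?_ hz
    exact (rotate_ae lam g f).trans ((measurePreserving_act lam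
      g⁻¹).quasiMeasurePreserving.ae_eq_comp (coe_ae_eq_holo f))
  · rw [holo_of_notMem _ hz, holo_of_notMem _ (mt (act_mem_domain _ z).1 hz)]

/-- A holomorphic function on the domain that vanishes near the origin vanishes. -/
theorem eqOn_zero_of_ball {f : (Fin n → ℂ) → ℂ} (hf : DifferentiableOn ℂ f (domain n)) {r : ℝ}
    (hr : 0 < r) (h : ∀ z ∈ Metric.ball (0 : Fin n → ℂ) r, f z = 0) : EqOn f 0 (domain n) := by
  intro z hz
  -- Reduction to one variable: the slice of the domain along the complex line through z is
  -- star-shaped about 0 and contains 1, so the identity theorem carries the vanishing from 0 to 1.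
  set U : Set ℂ := (fun ζ : ℂ => ζ • z) ⁻¹' domain n with hU
  have hUo : IsOpen U := isOpen_domain.preimage (by fun_prop)
  have h0 : (0 : ℂ) ∈ U := by simp [hU, zero_mem_domain]
  have hUc : IsPreconnected U := by
    refine (StarConvex.isPathConnected ?_ h0).isConnected.isPreconnected
    rw [starConvex_zero_iff]
    intro ζ hζ a ha0 ha1
    have := smul_mem_domain (ζ := (a : ℂ)) (by simpa [abs_of_nonneg ha0] using ha1) hζ
    simpa [hU, smul_smul] using this
  have hd : DifferentiableOn ℂ (fun ζ : ℂ => f (ζ • z)) U :=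
    hf.comp (by fun_prop) fun ζ hζ => hζ
  have hnear : (fun ζ : ℂ => f (ζ • z)) =ᶠ[𝓝 0] 0 := by
    have ht : Tendsto (fun ζ : ℂ => ζ • z) (𝓝 0) (𝓝 0) := by
      have : Continuous fun ζ : ℂ => ζ • z := by fun_prop
      simpa using this.tendsto 0
    filter_upwards [ht (Metric.ball_mem_nhds 0 hr)] with ζ hζ using h _ hζ
  have := (hd.analyticOnNhd hUo).eqOn_zero_of_preconnected_of_eventuallyEq_zero hUc h0 hnear
    (show (1 : ℂ) ∈ U by simpa [hU] using hz)
  simpa using this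

theorem eq_zero_of_holo_ball (f : bergman n lam) {r : ℝ} (hr : 0 < r)
    (h : ∀ z ∈ Metric.ball (0 : Fin n → ℂ) r, holo f z = 0) : f = 0 := by
  have h1 := eqOn_zero_of_ball (differentiableOn_holo f) hr h
  refine Subtype.ext (Lp.ext ?_)
  filter_upwards [coe_ae_eq_holo f, ae_mem_domain, Lp.coeFn_zero ℂ 2 (vlam n lam)]
    with z hz hzD h0
  rw [hz, h1 hzD]
  exact h0.symm

theorem exists_ball_subset_domain : ∃ r > 0, Metric.ball (0 : Fin n → ℂ) r ⊆ domain n :=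
  Metric.isOpen_iff.1 isOpen_domain 0 zero_mem_domain

/-! ### Compactness of restriction and density of finite-dimensional invariant subspaces. -/

theorem lintegral_holo (f : bergman n lam) :
    ∫⁻ z, ‖holo f z‖ₑ ^ 2 ∂(vlam n lam) = ‖f‖ₑ ^ 2 := by
  have : ‖f‖ₑ = ‖(f : L2 n lam)‖ₑ := rfl
  rw [this, Lp.enorm_def, eLpNorm_eq_lintegral_rpow_enorm_toReal (by norm_num) (by norm_num),
    ← ENNReal.rpow_natCast, ← ENNReal.rpow_mul]
  simp only [ENNReal.toReal_ofNat, Nat.cast_ofNat, one_div]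
  rw [inv_mul_cancel₀ two_ne_zero, ENNReal.rpow_one]
  refine lintegral_congr_ae ?_
  filter_upwards [coe_ae_eq_holo f] with z hz
  rw [hz]
  norm_cast

/-- Point evaluations near the origin are uniformly bounded. -/
theorem exists_norm_holo_le (hv : vlam n lam ≠ 0) :
    ∃ r > 0, Metric.ball (0 : Fin n → ℂ) r ⊆ domain n ∧ ∃ M : ℝ, 0 ≤ M ∧
      ∀ f : bergman n lam, ∀ z ∈ Metric.ball (0 : Fin n → ℂ) r, ‖holo f z‖ ≤ M * ‖f‖ := by
  obtain ⟨r, hr, hsub, C, hC, hb⟩ := exists_eval_bound (weight_univ_ne_zero hv)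
    (weight_univ_ne_top hv) zero_mem_domain
  refine ⟨r, hr, hsub, √C.toReal, Real.sqrt_nonneg _, fun f z hz => ?_⟩
  have h1 := hb (holo f) (differentiableOn_holo f) z hz
  rw [lintegral_holo, ← ENNReal.toReal_le_toReal (by simp) (ENNReal.mul_ne_top hC (by simp)),
    ENNReal.toReal_mul, ENNReal.toReal_pow, ENNReal.toReal_pow, toReal_enorm, toReal_enorm] at h1
  refine abs_le_of_sq_le_sq' ?_ (by positivity) |>.2
  rw [mul_pow, Real.sq_sqrt ENNReal.toReal_nonneg]
  exact h1

/-- Holomorphic functions bounded by `M` on a ball are Lipschitz on the ball of half the radius. -/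
theorem dist_le_of_bounded {f : (Fin n → ℂ) → ℂ} {r M : ℝ} (hr : 0 < r)
    (hf : DifferentiableOn ℂ f (Metric.ball 0 r)) (hM : ∀ z ∈ Metric.ball 0 r, ‖f z‖ ≤ M)
    {z w : Fin n → ℂ} (hz : ‖z‖ ≤ r / 2) (hw : ‖w‖ ≤ r / 2) :
    dist (f w) (f z) ≤ 2 * M / (r / 2) * dist w z := by
  have hzr : z ∈ Metric.ball (0 : Fin n → ℂ) r := by
    rw [mem_ball_zero_iff]; linarith
  have hwr : w ∈ Metric.ball (0 : Fin n → ℂ) r := by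
    rw [mem_ball_zero_iff]; linarith
  have hdist : ∀ u ∈ Metric.ball (0 : Fin n → ℂ) r, dist (f u) (f z) ≤ 2 * M := fun u hu =>
    (dist_le_norm_add_norm _ _).trans (by linarith [hM u hu, hM z hzr])
  have hM0 : 0 ≤ M := (norm_nonneg _).trans (hM z hzr)
  -- Near z this is the Schwarz lemma on the ball of radius r/2 about z; farther away the trivial
  -- bound 2M suffices.
  rcases lt_or_ge (dist w z) (r / 2) with h | h
  · have hsub : Metric.ball z (r / 2) ⊆ Metric.ball 0 r := by
      refine Metric.ball_subset_ball' ?_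
      rw [dist_zero_right]
      linarith
    exact Complex.dist_le_div_mul_dist_of_mapsTo_ball (hf.mono hsub)
      (fun u hu => hdist u (hsub hu)) h
  · refine (hdist w hwr).trans ?_
    rw [div_mul_eq_mul_div, le_div_iff₀ (by positivity)]
    gcongr

/-- The closed Euclidean ball of radius `r`. -/
def eBall (n : ℕ) (r : ℝ) : Set (Fin n → ℂ) := {z | normSq z ≤ r ^ 2}

theorem isClosed_eBall (r : ℝ) : IsClosed (eBall n r) :=
  isClosed_le continuous_normSq continuous_const

theorem norm_le_of_mem_eBall {r : ℝ} (hr : 0 ≤ r) {z : Fin n → ℂ} (hz : z ∈ eBall n r) :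
    ‖z‖ ≤ r :=
  abs_le_of_sq_le_sq' ((norm_sq_le_normSq z).trans hz) hr |>.2

theorem isCompact_eBall {r : ℝ} (hr : 0 ≤ r) : IsCompact (eBall n r) :=
  (isCompact_closedBall (0 : Fin n → ℂ) r).of_isClosed_subset (isClosed_eBall r) fun _ hz =>
    mem_closedBall_zero_iff.2 (norm_le_of_mem_eBall hr hz)

/-- This is the reason for Euclidean balls: sup-norm balls are not preserved by all rotations. -/
theorem act_mem_eBall {r : ℝ} (g : SOxSO2 n) (z : Fin n → ℂ) :
    act g z ∈ eBall n r ↔ z ∈ eBall n r := by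
  simp [eBall, normSq_act]

theorem exists_ball_subset_eBall {r : ℝ} (hr : 0 < r) :
    ∃ ε > 0, Metric.ball (0 : Fin n → ℂ) ε ⊆ eBall n r := by
  have hopen : IsOpen {z : Fin n → ℂ | normSq z < r ^ 2} :=
    isOpen_lt continuous_normSq continuous_const
  obtain ⟨ε, hε, h⟩ := Metric.isOpen_iff.1 hopen 0 (by simp [normSq, hr])
  exact ⟨ε, hε, fun z hz => (show normSq z < r ^ 2 from h hz).le⟩

open BoundedContinuousFunction in
/-- Restriction to a small ball is a compact operator from the Bergman space to the continuous
functions. -/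
theorem exists_compact_restriction (hv : vlam n lam ≠ 0) :
    ∃ r > 0, eBall n r ⊆ domain n ∧ ∃ R : bergman n lam →L[ℂ] (eBall n r →ᵇ ℂ),
      IsCompactOperator R ∧ ∀ f (x : eBall n r), R f x = holo f x := by
  obtain ⟨r, hr, hsub, M, hM0, hM⟩ := exists_norm_holo_le hv
  have hnorm : ∀ z ∈ eBall n (r / 2), ‖z‖ ≤ r / 2 := fun z hz =>
    norm_le_of_mem_eBall (by positivity) hz
  have hball : eBall n (r / 2) ⊆ Metric.ball 0 r := fun z hz => by
    rw [mem_ball_zero_iff]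
    linarith [hnorm z hz]
  have hsub' : eBall n (r / 2) ⊆ domain n := hball.trans hsub
  have : CompactSpace (eBall n (r / 2)) :=
    isCompact_iff_compactSpace.1 (isCompact_eBall (by positivity))
  let R₀ : bergman n lam →ₗ[ℂ] (eBall n (r / 2) →ᵇ ℂ) :=
    { toFun := fun f => mkOfCompact ⟨(eBall n (r / 2)).domRestrict (holo f),
        ((differentiableOn_holo f).continuousOn.mono hsub').domRestrict⟩
      map_add' := fun f g => by
        ext x
        exact map_add (evalAt hv x) f g
      map_smul' := fun c f => by
        ext x
        exact map_smul (evalAt hv x) c f }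
  have hR₀ : ∀ f (x : eBall n (r / 2)), R₀ f x = holo f x := fun f x => rfl
  let R : bergman n lam →L[ℂ] (eBall n (r / 2) →ᵇ ℂ) := R₀.mkContinuous M fun f => by
    refine (BoundedContinuousFunction.norm_le (by positivity)).2 fun x => ?_
    exact hM f x (hball x.2)
  refine ⟨r / 2, by positivity, hsub', R, ?_, hR₀⟩
  refine (isCompactOperator_iff_isCompact_closure_image_closedBall
    (R : bergman n lam →ₗ[ℂ] (eBall n (r / 2) →ᵇ ℂ)) one_pos).2 ?_
  have hle : ∀ f ∈ Metric.closedBall (0 : bergman n lam) 1, ∀ z ∈ Metric.ball 0 r,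
      ‖holo f z‖ ≤ M := by
    intro f hf z hz
    rw [mem_closedBall_zero_iff] at hf
    exact (hM f z hz).trans (mul_le_of_le_one_right hM0 hf)
  -- Montel's argument: the unit ball is uniformly bounded on the larger ball, hence has a common
  -- Lipschitz constant on the smaller one.
  refine arzela_ascoli (Metric.closedBall 0 M) (isCompact_closedBall _ _) _ ?_ ?_
  · rintro _ x ⟨f, hf, rfl⟩
    rw [mem_closedBall_zero_iff]
    exact hle f hf x (hball x.2)
  · refine UniformEquicontinuous.equicontinuous ?_
    refine Metric.uniformEquicontinuous_of_continuity_modulus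
      (fun t => 2 * M / (r / 2) * t) ?_ _ ?_
    · have : Continuous fun t : ℝ => 2 * M / (r / 2) * t := by fun_prop
      simpa using this.tendsto 0
    · rintro x y ⟨_, f, hf, rfl⟩
      exact dist_le_of_bounded hr ((differentiableOn_holo f).mono hsub) (hle f hf)
        (hnorm y y.2) (hnorm x x.2)

open BoundedContinuousFunction in
/-- There is an injective compact self-adjoint operator commuting with the representation. -/
theorem exists_compact_intertwiner (hv : vlam n lam ≠ 0) :
    ∃ T : bergman n lam →L[ℂ] bergman n lam, IsCompactOperator T ∧ IsSelfAdjoint T ∧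
      (∀ f, T f = 0 → f = 0) ∧ ∀ g f, T (piLam n lam g f) = piLam n lam g (T f) := by
  obtain ⟨r, hr, hsub, R, hRc, hR⟩ := exists_compact_restriction (lam := lam) hv
  have hKm : MeasurableSet (eBall n r) := (isClosed_eBall r).measurableSet
  set ν : Measure (eBall n r) := (vlam n lam).comap Subtype.val with hν
  have : IsFiniteMeasure ν := by
    refine ⟨?_⟩
    rw [hν, comap_subtype_coe_apply hKm]
    exact measure_lt_top _ _
  -- The operator sought is J*J, that is, the Toeplitz operator whose symbol is the indicator of the
  -- invariant ball.
  let J : bergman n lam →L[ℂ] Lp ℂ 2 ν := (toLp 2 ν ℂ) ∘L R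
  have hJ : ∀ f, J f =ᵐ[ν] fun x => holo f x := fun f => by
    filter_upwards [coeFn_toLp 2 ν ℂ (R f)] with x hx
    rw [← hR]
    exact hx
  have hinner : ∀ f h, inner ℂ (J f) (J h) =
      ∫ z in eBall n r, inner ℂ (holo f z) (holo h z) ∂(vlam n lam) := by
    intro f h
    rw [L2.inner_def, ← integral_subtype_comap hKm]
    refine integral_congr_ae ?_
    filter_upwards [hJ f, hJ h] with x h1 h2
    rw [h1, h2]
  have hinv : ∀ g f h, inner ℂ (J (piLam n lam g f)) (J (piLam n lam g h)) =
      inner ℂ (J f) (J h) := by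
    intro g f h
    rw [hinner, hinner]
    simp only [holo_piLam hv]
    have hmp := measurePreserving_act lam g⁻¹
    have hme : MeasurableEmbedding (act g⁻¹ : (Fin n → ℂ) → _) := by
      refine (continuous_act g⁻¹).measurableEmbedding fun z w hzw => ?_
      have := congrArg (act g) hzw
      simpa [← act_mul, act_one] using this
    have hpre : act g⁻¹ ⁻¹' eBall n r = eBall n r := by
      ext z
      exact act_mem_eBall _ _
    have := hmp.setIntegral_preimage_emb hme (fun z => inner ℂ (holo f z) (holo h z)) (eBall n r)
    rwa [hpre] at this
  refine ⟨J.adjoint ∘L J, ?_, ?_, fun f hf => ?_, fun g f => ?_⟩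
  · exact (hRc.clm_comp (toLp 2 ν ℂ)).clm_comp J.adjoint
  · rw [ContinuousLinearMap.isSelfAdjoint_iff', ContinuousLinearMap.adjoint_comp,
      ContinuousLinearMap.adjoint_adjoint]
  · have h0 : ∫ z in eBall n r, (‖holo f z‖ ^ 2 : ℝ) ∂(vlam n lam) = 0 := by
      have h1 : inner ℂ (J f) (J f) = 0 := by
        rw [← ContinuousLinearMap.adjoint_inner_right]
        change inner ℂ f ((J.adjoint ∘L J) f) = 0
        rw [hf, inner_zero_right]
      rw [hinner] at h1
      simp only [inner_self_eq_norm_sq_to_K] at h1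
      have h2 := h1
      simp only [Complex.coe_algebraMap, ← Complex.ofReal_pow] at h2
      rw [integral_complex_ofReal] at h2
      exact_mod_cast h2
    have hcont : ContinuousOn (fun z => (‖holo f z‖ ^ 2 : ℝ)) (eBall n r) :=
      (((differentiableOn_holo f).continuousOn.mono hsub).norm.pow 2)
    have hint : IntegrableOn (fun z => (‖holo f z‖ ^ 2 : ℝ)) (eBall n r) (vlam n lam) :=
      hcont.integrableOn_compact (isCompact_eBall hr.le)
    rw [integral_eq_zero_iff_of_nonneg (fun _ => by positivity) hint] at h0
    obtain ⟨ε, hε, hsubε⟩ := exists_ball_subset_eBall (n := n) hr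
    refine eq_zero_of_holo_ball f hε ?_
    refine eqOn_of_ae_eq hv (g := fun _ => 0) Metric.isOpen_ball (hsubε.trans hsub)
      ((differentiableOn_holo f).continuousOn.mono (hsubε.trans hsub)) continuousOn_const ?_
    rw [Filter.EventuallyEq, ae_restrict_iff' hKm] at h0
    filter_upwards [h0] with z hz hzε
    simpa using hz (hsubε hzε)
  · refine ext_inner_left ℂ fun h => ?_
    have hback : h = piLam n lam g (piLam n lam g⁻¹ h) := by
      change h = (piLam n lam g * piLam n lam g⁻¹) h
      rw [← map_mul, mul_inv_cancel, map_one]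
      rfl
    rw [← inv_inv g, ← UnitaryRep.inner_apply_left, inv_inv]
    change inner ℂ h (J.adjoint (J _)) = inner ℂ _ (J.adjoint (J _))
    rw [ContinuousLinearMap.adjoint_inner_right, ContinuousLinearMap.adjoint_inner_right]
    conv_lhs => rw [hback]
    exact hinv g _ _

/-- The finite-dimensional invariant subspaces of the Bergman space span a dense subspace. -/
theorem orthogonal_sSup_invariant_eq_bot (hv : vlam n lam ≠ 0) (H : Subgroup (SOxSO2 n)) :
    (sSup {F : Submodule ℂ (bergman n lam) | FiniteDimensional ℂ F ∧
      UnitaryRep.IsInvariant ((piLam n lam).comp H.subtype) F})ᗮ = ⊥ := by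
  obtain ⟨T, hTc, hTs, hT0, hTg⟩ := exists_compact_intertwiner (lam := lam) hv
  rw [eq_bot_iff, ← ContinuousLinearMap.orthogonalComplement_iSup_eigenspaces_eq_bot hTc
    hTs.isSymmetric]
  refine Submodule.orthogonal_le (iSup_le fun μ => ?_)
  -- The eigenspace of 0 is trivial by injectivity; the others are finite-dimensional by
  -- compactness.
  rcases eq_or_ne μ 0 with rfl | hμ
  · intro f hf
    rw [Module.End.mem_eigenspace_iff, zero_smul] at hf
    rw [hT0 f hf]
    exact zero_mem _
  · have := ContinuousLinearMap.finite_dimensional_eigenspace hTc μ hμ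
    refine le_sSup ⟨this, UnitaryRep.isInvariant_of_finiteDimensional _ _ fun g f hf => ?_⟩
    rw [Module.End.mem_eigenspace_iff] at hf ⊢
    have h1 : T f = μ • f := hf
    change T (piLam n lam g f) = μ • piLam n lam g f
    rw [hTg, h1, map_smul]

end CartanIV

/-! ### Trace duality, commutants and compressions. -/

namespace UnitaryRep

variable {G : Type*} [Group G] {E : Type*} [NormedAddCommGroup E] [InnerProductSpace ℂ E]

theorem inner_apply_eq_sum {X ι : Type*} [NormedAddCommGroup X] [InnerProductSpace ℂ X] [Fintype ι]
    (e : OrthonormalBasis ι ℂ X) (S : X →ₗ[ℂ] X) (u v : X) :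
    inner ℂ u (S v) = ∑ i, inner ℂ (e i) v * inner ℂ u (S (e i)) := by
  conv_lhs => rw [← e.sum_repr' v]
  simp only [map_sum, map_smul, _root_.inner_sum, inner_smul_right]

/-- A linear map that annihilates a total family vanishes. -/
theorem eq_zero_of_total {X ι : Type*} [NormedAddCommGroup X] [InnerProductSpace ℂ X]
    [FiniteDimensional ℂ X] (S : X →ₗ[ℂ] X) (s : Set ι) (k : ι → X)
    (hk : ∀ x, (∀ i ∈ s, inner ℂ (k i) x = 0) → x = 0) (hS : ∀ i ∈ s, S (k i) = 0) : S = 0 := by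
  have hadj : LinearMap.adjoint S = 0 := by
    refine LinearMap.ext fun y => hk _ fun i hi => ?_
    rw [LinearMap.adjoint_inner_right, hS i hi, inner_zero_left]
  rw [← LinearMap.adjoint_adjoint S, hadj, map_zero]

/-- A subspace of endomorphisms with trivial trace-orthogonal complement in a larger one is equal
to it. -/
theorem eq_of_trace_orthogonal {X : Type*} [AddCommGroup X] [Module ℂ X] [FiniteDimensional ℂ X]
    {A B : Submodule ℂ (X →ₗ[ℂ] X)} (hAB : A ≤ B)
    (h : ∀ S ∈ B, (∀ T ∈ A, LinearMap.trace ℂ X (S * T) = 0) → S = 0) : A = B := by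
  -- By hypothesis the trace pairing embeds B into the dual of A, so dim B ≤ dim A.
  let φ : B →ₗ[ℂ] Module.Dual ℂ A :=
    ((LinearMap.mul ℂ (Module.End ℂ X)).compr₂ (LinearMap.trace ℂ X)).domRestrict₁₂ B A
  have hφ : Function.Injective φ := (injective_iff_map_eq_zero φ).2 fun S hS =>
    Subtype.ext (h S S.2 fun T hT => LinearMap.congr_fun hS ⟨T, hT⟩)
  have hfr := LinearMap.finrank_le_finrank_of_injective hφ
  rw [Subspace.dual_finrank_eq] at hfr
  exact Submodule.eq_of_le_of_finrank_le hAB hfr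

/-- The linear endomorphisms of a subspace that commute with the representation. -/
def commutant (π : G →* (E ≃ₗᵢ[ℂ] E)) (C : Submodule ℂ E) : Submodule ℂ (C →ₗ[ℂ] C) where
  carrier := {S | ∀ (g : G) (x y : C), (y : E) = π g x → (S y : E) = π g (S x)}
  zero_mem' g x y _ := by simp
  add_mem' hS hT g x y h := by simp [hS g x y h, hT g x y h]
  smul_mem' c S hS g x y h := by simp [hS g x y h]

/-- The compression of an operator to a subspace. -/
def compress (C : Submodule ℂ E) [C.HasOrthogonalProjection] :
    (E →L[ℂ] E) →ₗ[ℂ] C →ₗ[ℂ] C where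
  toFun T := (C.orthogonalProjectionOnto ∘L T ∘L C.subtypeL : C →L[ℂ] C)
  map_add' S T := by ext; simp
  map_smul' c T := by ext; simp

theorem compress_apply (C : Submodule ℂ E) [C.HasOrthogonalProjection] (T : E →L[ℂ] E) (x : C) :
    compress C T x = C.orthogonalProjectionOnto (T x) := rfl

theorem coe_compress_apply (C : Submodule ℂ E) [C.HasOrthogonalProjection] {T : E →L[ℂ] E} {x : C}
    (h : T x ∈ C) : (compress C T x : E) = T x :=
  Submodule.starProjection_eq_self_iff.2 h

variable [CompleteSpace E]

theorem compress_mem_commutant {π : G →* (E ≃ₗᵢ[ℂ] E)} {C : Submodule ℂ E}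
    [C.HasOrthogonalProjection] (hC : IsInvariant π C) {T : E →L[ℂ] E} (hT : T ∈ intertwiners π) :
    compress C T ∈ commutant π C := by
  intro g x y h
  change C.starProjection (T y) = π g (C.starProjection (T x))
  rw [h, mem_intertwiners_iff.1 hT, hC.starProjection_apply]

theorem isClosed_intertwiners (π : G →* (E ≃ₗᵢ[ℂ] E)) :
    IsClosed (intertwiners π : Set (E →L[ℂ] E)) := by
  change IsClosed {T : E →L[ℂ] E | ∀ g, T * op π g = op π g * T}
  simp only [Set.ofPred_forall]
  exact isClosed_iInter fun g => isClosed_eq (by fun_prop) (by fun_prop)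

theorem subset_cstarAlgebra (s : Set (E →L[ℂ] E)) : s ⊆ cstarAlgebra s := fun _ hT =>
  StarSubalgebra.le_topologicalClosure _ (StarAlgebra.subset_adjoin ℂ s hT)

theorem cstarAlgebra_le_intertwiners {π : G →* (E ≃ₗᵢ[ℂ] E)} {s : Set (E →L[ℂ] E)}
    (hs : ∀ T ∈ s, T ∈ intertwiners π) {T : E →L[ℂ] E} (hT : T ∈ cstarAlgebra s) :
    T ∈ intertwiners π := by
  have : cstarAlgebra s ≤ (intertwiners π).toStarSubalgebra :=
    StarSubalgebra.topologicalClosure_minimal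
      (StarAlgebra.adjoin_le_iff.2 hs) (isClosed_intertwiners π)
  exact this hT

end UnitaryRep

/-! ### Toeplitz operators with invariant symbols. -/

namespace CartanIV

variable {n : ℕ} {lam : ℝ}

theorem mulOp_rotate {H : Subgroup (SOxSO2 n)} {a : Linfty n lam}
    (ha : a ∈ invariantSymbols lam H) {h : SOxSO2 n} (hh : h ∈ H) (f : L2 n lam) :
    mulOp lam a (rotate lam h f) = rotate lam h (mulOp lam a f) := by
  have hmp := measurePreserving_act lam h⁻¹
  refine Lp.ext ?_
  have h1 : (fun z => a (act h⁻¹ z)) =ᵐ[vlam n lam] a := by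
    have := Lp.coeFn_compMeasurePreserving a hmp
    have h2 : Lp.compMeasurePreserving (act h⁻¹) hmp a = a := ha h hh
    rw [h2] at this
    exact this.symm
  filter_upwards [h1, mulOp_ae lam a (rotate lam h f), rotate_ae lam h f,
    rotate_ae lam h (mulOp lam a f),
    hmp.quasiMeasurePreserving.ae_eq_comp (mulOp_ae lam a f)] with z e1 e2 e3 e4 e5
  rw [e2, e3, e4, ← e1]
  exact e5.symm

/-- Toeplitz operators with invariant symbols commute with the representation. -/
theorem toeplitz_mem_intertwiners {H : Subgroup (SOxSO2 n)} {a : Linfty n lam}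
    (ha : a ∈ invariantSymbols lam H) :
    toeplitz lam a ∈ UnitaryRep.intertwiners ((piLam n lam).comp H.subtype) := by
  refine UnitaryRep.mem_intertwiners_iff.2 fun g f => ?_
  -- Tested against vectors of the Bergman space, the projection drops out and only multiplication
  -- by the symbol remains.
  refine ext_inner_left ℂ fun u => ?_
  have h := UnitaryRep.inner_apply_left ((piLam n lam).comp H.subtype) g⁻¹ u (toeplitz lam a f)
  rw [inv_inv] at h
  rw [← h]
  change inner ℂ u ((bergman n lam).orthogonalProjectionOnto (mulOp lam a (rotate lam g f))) =
    inner ℂ _ ((bergman n lam).orthogonalProjectionOnto (mulOp lam a f))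
  rw [Submodule.inner_orthogonalProjectionOnto_eq_of_mem_left,
    Submodule.inner_orthogonalProjectionOnto_eq_of_mem_left, mulOp_rotate ha g.2]
  change inner ℂ (u : L2 n lam) _ = inner ℂ (rotate lam ((g⁻¹ : H) : SOxSO2 n) (u : L2 n lam)) _
  rw [← (rotate lam (g : SOxSO2 n)).inner_map_map (rotate lam ((g⁻¹ : H) : SOxSO2 n) _),
    ← rotate_mul]
  simp [rotate_one]

/-- This disposes of the degenerate case: `vlam` is the zero measure when the total weight is 0 or
∞. -/
theorem subsingleton_bergman (hv : vlam n lam = 0) : Subsingleton (bergman n lam) :=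
  ⟨fun f g => Subtype.ext (Lp.ext (by simp [Filter.EventuallyEq, hv]))⟩

/-- The Toeplitz operator as a linear function of the symbol. -/
def toeplitzₗ (n : ℕ) (lam : ℝ) : Linfty n lam →ₗ[ℂ] (bergman n lam →L[ℂ] bergman n lam) where
  toFun := toeplitz lam
  map_add' a b := by
    simp only [toeplitz, mulOp, map_add, ContinuousLinearMap.add_comp,
      ContinuousLinearMap.comp_add]
  map_smul' c a := by
    simp only [toeplitz, mulOp, map_smul, ContinuousLinearMap.smul_comp,
      ContinuousLinearMap.comp_smul, RingHom.id_apply]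

theorem measurable_holo (f : bergman n lam) : Measurable (holo f) := by
  classical
  have h := (differentiableOn_holo f).continuousOn.measurable_piecewise (g := fun _ => 0)
    continuousOn_const isOpen_domain.measurableSet
  have : (domain n).piecewise (holo f) (fun _ => 0) = holo f := by
    ext z
    by_cases hz : z ∈ domain n
    · simp [hz]
    · simp [hz, holo_of_notMem f hz]
  rwa [this] at h

/-! ### Reproducing kernels of finite-dimensional subspaces. -/

section Kernel

variable (hv : vlam n lam ≠ 0) (C : Submodule ℂ (bergman n lam)) [FiniteDimensional ℂ C]

/-- The reproducing kernel of a finite-dimensional subspace of the Bergman space. -/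
def kernel (z : Fin n → ℂ) : C :=
  (InnerProductSpace.toDual ℂ C).symm (LinearMap.toContinuousLinearMap (evalAt hv z ∘ₗ C.subtype))

theorem inner_kernel (z : Fin n → ℂ) (f : C) :
    inner ℂ (kernel hv C z) f = holo (f : bergman n lam) z := by
  rw [kernel, InnerProductSpace.toDual_symm_apply]
  rfl

/-- Evaluating f at hz is evaluating π(h)⁻¹f at z, and π(h) is unitary. -/
theorem kernel_act {H : Subgroup (SOxSO2 n)}
    (hC : UnitaryRep.IsInvariant ((piLam n lam).comp H.subtype) C) (h : H) (z : Fin n → ℂ) :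
    (kernel hv C (act (h : SOxSO2 n) z) : bergman n lam) = piLam n lam h (kernel hv C z) := by
  have hmem := hC.2 h _ (kernel hv C z).2
  suffices hs : kernel hv C (act (h : SOxSO2 n) z) = ⟨_, hmem⟩ from congrArg Subtype.val hs
  refine ext_inner_right ℂ fun f => ?_
  rw [inner_kernel]
  have h1 := UnitaryRep.inner_apply_left ((piLam n lam).comp H.subtype) h (kernel hv C z) f
  have h2 := inner_kernel hv C z ⟨_, hC.2 h⁻¹ _ f.2⟩
  refine Eq.trans ?_ (h2.symm.trans h1.symm)
  change _ = holo (piLam n lam ((h⁻¹ : H) : SOxSO2 n) f) z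
  rw [holo_piLam hv]
  simp

/-- The sesquiholomorphic kernel of an endomorphism. -/
def opKernel (S : C →ₗ[ℂ] C) (z w : Fin n → ℂ) : ℂ :=
  inner ℂ (kernel hv C z) (S (kernel hv C w))

/-- Covariance of the kernel and unitarity cancel. This is what makes symbols built from the
diagonal invariant. -/
theorem opKernel_act {H : Subgroup (SOxSO2 n)}
    (hC : UnitaryRep.IsInvariant ((piLam n lam).comp H.subtype) C) {S : C →ₗ[ℂ] C}
    (hS : S ∈ UnitaryRep.commutant ((piLam n lam).comp H.subtype) C) (h : H) (z : Fin n → ℂ) :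
    opKernel hv C S (act (h : SOxSO2 n) z) (act (h : SOxSO2 n) z) = opKernel hv C S z z := by
  have h1 := kernel_act hv C hC h z
  have h2 := hS h _ _ h1
  rw [opKernel, opKernel, Submodule.coe_inner, Submodule.coe_inner, h1, h2]
  exact (piLam n lam h).inner_map_map _ _

/-- The expansion exhibits holomorphy in z and antiholomorphy in w on the domain. -/
theorem opKernel_eq_sum {ι : Type*} [Fintype ι] (e : OrthonormalBasis ι ℂ C) (S : C →ₗ[ℂ] C)
    (z w : Fin n → ℂ) :
    opKernel hv C S z w =
      ∑ i, star (holo (e i : bergman n lam) w) * holo (S (e i) : bergman n lam) z := by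
  rw [opKernel]
  refine (UnitaryRep.inner_apply_eq_sum e S _ _).trans (Finset.sum_congr rfl fun i _ => ?_)
  rw [inner_kernel]
  exact congrArg (· * _)
    ((inner_conj_symm (e i) (kernel hv C w)).symm.trans (congrArg star (inner_kernel hv C w (e i))))

theorem measurable_opKernel (S : C →ₗ[ℂ] C) : Measurable fun z => opKernel hv C S z z := by
  simp only [opKernel_eq_sum hv C (stdOrthonormalBasis ℂ C)]
  exact Finset.measurable_sum _ fun i _ =>
    (continuous_star.measurable.comp (measurable_holo _)).mul (measurable_holo _)

theorem continuousOn_opKernel (S : C →ₗ[ℂ] C) :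
    ContinuousOn (fun z => opKernel hv C S z z) (domain n) := by
  simp only [opKernel_eq_sum hv C (stdOrthonormalBasis ℂ C)]
  exact continuousOn_finsetSum _ fun i _ =>
    ((differentiableOn_holo _).continuousOn.star).mul (differentiableOn_holo _).continuousOn

/-- The trace of the product with a compressed Toeplitz operator is the integral of the symbol
against the diagonal of the kernel. -/
theorem trace_mul_compress (S : C →ₗ[ℂ] C) (a : Linfty n lam) :
    LinearMap.trace ℂ C (S * UnitaryRep.compress C (toeplitz lam a)) =
      ∫ z, a z * opKernel hv C S z z ∂(vlam n lam) := by
  set e := stdOrthonormalBasis ℂ C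
  -- With S moved to the right, both projections in the compressed Toeplitz operator disappear
  -- against the basis vectors, which lie in C.
  rw [LinearMap.trace_mul_comm, LinearMap.trace_eq_sum_inner _ e]
  have h1 : ∀ i, inner ℂ (e i) ((UnitaryRep.compress C (toeplitz lam a) * S) (e i)) =
      ∫ z, inner ℂ (((e i : bergman n lam) : L2 n lam) z)
        (mulOp lam a (S (e i) : bergman n lam) z) ∂(vlam n lam) := by
    intro i
    rw [← L2.inner_def, Module.End.mul_apply, UnitaryRep.compress_apply,
      Submodule.inner_orthogonalProjectionOnto_eq_of_mem_left]
    exact Submodule.inner_orthogonalProjectionOnto_eq_of_mem_left _ _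
  simp only [h1]
  rw [← integral_finsetSum _ fun i _ => L2.integrable_inner _ _]
  refine integral_congr_ae ?_
  have h2 : ∀ᵐ z ∂(vlam n lam), ∀ i, ((e i : bergman n lam) : L2 n lam) z =
      holo (e i : bergman n lam) z :=
    ae_all_iff.2 fun i => coe_ae_eq_holo _
  have h3 : ∀ᵐ z ∂(vlam n lam), ∀ i, mulOp lam a (S (e i) : bergman n lam) z =
      a z * holo (S (e i) : bergman n lam) z := ae_all_iff.2 fun i => by
    filter_upwards [mulOp_ae lam a (S (e i) : bergman n lam),
      coe_ae_eq_holo (S (e i) : bergman n lam)]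
      with z e1 e2
    rw [e1, e2]
  filter_upwards [h2, h3] with z h2 h3
  rw [opKernel_eq_sum hv C e, Finset.mul_sum]
  refine Finset.sum_congr rfl fun i _ => ?_
  rw [h2, h3, RCLike.inner_apply]
  change _ * star _ = _
  ring

/-- An endomorphism whose kernel vanishes on the diagonal vanishes. -/
theorem eq_zero_of_opKernel_diag (S : C →ₗ[ℂ] C)
    (h : ∀ z ∈ domain n, opKernel hv C S z z = 0) : S = 0 := by
  obtain ⟨r, hr, hsub⟩ := exists_ball_subset_domain (n := n)
  set e := stdOrthonormalBasis ℂ C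
  have hpol : ∀ z ∈ Metric.ball (0 : Fin n → ℂ) (r / 4),
      ∀ w ∈ Metric.ball (0 : Fin n → ℂ) (r / 4),
      opKernel hv C S z w = 0 := by
    intro z hz w hw
    rw [mem_ball_zero_iff] at hz hw
    -- Polarization: p and q solve p + iq = z and p - iq = w. The function u(ζ) below, the kernel at
    -- (p + ζq, p + ζ̄q), is holomorphic and vanishes for real ζ, hence at ζ = i. The radius r/4
    -- keeps p + ζq in the ball of radius r for |ζ| < 2.
    set p : Fin n → ℂ := (1 / 2 : ℂ) • (z + w) with hp
    set q : Fin n → ℂ := (1 / (2 * Complex.I) : ℂ) • (z - w) with hq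
    have hpn : ‖p‖ < r / 4 := by
      rw [hp, norm_smul]
      have := norm_add_le z w
      norm_num
      linarith
    have hqn : ‖q‖ < r / 4 := by
      rw [hq, norm_smul]
      have := norm_sub_le z w
      norm_num
      linarith
    have hmem : ∀ ζ ∈ Metric.ball (0 : ℂ) 2, p + ζ • q ∈ domain n := by
      intro ζ hζ
      rw [mem_ball_zero_iff] at hζ
      refine hsub ?_
      rw [mem_ball_zero_iff]
      have h1 : ‖p + ζ • q‖ ≤ ‖p‖ + ‖ζ‖ * ‖q‖ := (norm_add_le _ _).trans_eq (by rw [norm_smul ζ q])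
      nlinarith [norm_nonneg q]
    have hline : ∀ f : bergman n lam, ∀ ζ ∈ Metric.ball (0 : ℂ) 2,
        DifferentiableAt ℂ (fun ζ : ℂ => holo f (p + ζ • q)) ζ := by
      intro f ζ hζ
      have h1 := (differentiableOn_holo f).differentiableAt
        (isOpen_domain.mem_nhds (hmem ζ hζ))
      exact DifferentiableAt.comp ζ h1 (by fun_prop)
    set u : ℂ → ℂ := fun ζ => opKernel hv C S (p + ζ • q) (p + (star ζ) • q) with hu
    have hud : DifferentiableOn ℂ u (Metric.ball 0 2) := by
      intro ζ hζ
      refine DifferentiableAt.differentiableWithinAt ?_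
      simp only [hu, opKernel_eq_sum hv C e]
      refine DifferentiableAt.fun_sum fun i _ => DifferentiableAt.mul ?_ (hline _ ζ hζ)
      have hζ' : star ζ ∈ Metric.ball (0 : ℂ) 2 := by
        rw [mem_ball_zero_iff] at hζ ⊢
        rwa [norm_star]
      have := (hline (e i : bergman n lam) _ hζ').star_star
      rw [star_star] at this
      exact this
    have hfreq : ∃ᶠ ζ in 𝓝[≠] (0 : ℂ), u ζ = 0 := by
      have ht : Tendsto (fun t : ℝ => (t : ℂ)) (𝓝[≠] 0) (𝓝[≠] 0) := by
        refine tendsto_nhdsWithin_iff.2 ⟨?_, ?_⟩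
        · exact (Complex.continuous_ofReal.tendsto' 0 0 (by simp)).mono_left nhdsWithin_le_nhds
        · filter_upwards [self_mem_nhdsWithin] with t ht
          simpa using ht
      refine ht.frequently (Eventually.frequently ?_)
      have hball : Metric.ball (0 : ℝ) 2 ∈ 𝓝[≠] (0 : ℝ) :=
        nhdsWithin_le_nhds (Metric.ball_mem_nhds 0 two_pos)
      filter_upwards [hball] with t ht
      have : star (t : ℂ) = t := Complex.conj_ofReal t
      rw [hu]
      simp only [this]
      exact h _ (hmem _ (by simpa using ht))
    have hua := hud.analyticOnNhd Metric.isOpen_ball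
    have hI := hua.eqOn_zero_of_preconnected_of_frequently_eq_zero
      (convex_ball (0 : ℂ) 2).isPreconnected (by simp) hfreq
      (show Complex.I ∈ Metric.ball (0 : ℂ) 2 by simp)
    have e1 : p + Complex.I • q = z := by
      ext i
      simp [hp, hq]
      field_simp
      linear_combination (w i - z i) * Complex.I_sq
    have e2 : p + (star Complex.I) • q = w := by
      ext i
      simp [hp, hq]
      field_simp
      linear_combination (z i - w i) * Complex.I_sq
    rw [hu] at hI
    simp only [e1, e2] at hI
    exact hI
  -- As a holomorphic function, S k_w vanishes near the origin, hence everywhere; for the same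
  -- reason the k_w with w near the origin are total in C.
  have hk : ∀ w ∈ Metric.ball (0 : Fin n → ℂ) (r / 4), S (kernel hv C w) = 0 := fun w hw =>
    Subtype.ext (eq_zero_of_holo_ball _ (r := r / 4) (by positivity) fun z hz => by
      rw [← inner_kernel hv C]
      exact hpol z hz w hw)
  exact UnitaryRep.eq_zero_of_total S (Metric.ball (0 : Fin n → ℂ) (r / 4)) (kernel hv C)
    (fun x hx => Subtype.ext (eq_zero_of_holo_ball _ (r := r / 4) (by positivity) fun w hw => by
      rw [← inner_kernel hv C, hx w hw])) hk

end Kernel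

/-! ### Toeplitz operators exhaust the commutant. -/

/-- An element of the commutant that is trace-orthogonal to all Toeplitz operators with invariant
symbols vanishes. -/
theorem eq_zero_of_trace_eq_zero (hv : vlam n lam ≠ 0)
    (C : Submodule ℂ (bergman n lam)) [FiniteDimensional ℂ C] {H : Subgroup (SOxSO2 n)}
    (hC : UnitaryRep.IsInvariant ((piLam n lam).comp H.subtype) C) {S : C →ₗ[ℂ] C}
    (hS : S ∈ UnitaryRep.commutant ((piLam n lam).comp H.subtype) C)
    (h : ∀ a ∈ invariantSymbols lam H,
      LinearMap.trace ℂ C (S * UnitaryRep.compress C (toeplitz lam a)) = 0) : S = 0 := by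
  set Φ : (Fin n → ℂ) → ℂ := fun z => opKernel hv C S z z with hΦ
  -- The conjugate of Φ makes the integrand nonnegative; the denominator makes the symbol bounded,
  -- as Φ may be unbounded on the domain.
  set φ : (Fin n → ℂ) → ℂ := fun z => star (Φ z) / ((1 + ‖Φ z‖ ^ 2 : ℝ) : ℂ) with hφ
  have hΦm : Measurable Φ := measurable_opKernel hv C S
  have hφm : Measurable φ := (continuous_star.measurable.comp hΦm).div
    (Complex.measurable_ofReal.comp (measurable_const.add (hΦm.norm.pow_const 2)))
  have hφb : ∀ z, ‖φ z‖ ≤ 1 := fun z => by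
    rw [hφ, norm_div, norm_star, Complex.norm_real, Real.norm_of_nonneg (by positivity),
      div_le_one (by positivity)]
    nlinarith [sq_nonneg (‖Φ z‖ - 1), sq_nonneg ‖Φ z‖]
  have hmem : MemLp φ ∞ (vlam n lam) :=
    memLp_top_of_bound hφm.aestronglyMeasurable 1 (Eventually.of_forall hφb)
  have hinv : hmem.toLp φ ∈ invariantSymbols lam H := by
    intro g hg
    have hmp := measurePreserving_act lam g⁻¹
    refine Lp.ext ((Lp.coeFn_compMeasurePreserving _ hmp).trans ?_)
    refine (hmp.quasiMeasurePreserving.ae_eq_comp hmem.coeFn_toLp).trans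
      (EventuallyEq.trans ?_ hmem.coeFn_toLp.symm)
    refine Eventually.of_forall fun z => ?_
    have := opKernel_act hv C hC hS ⟨g⁻¹, H.inv_mem hg⟩ z
    simp only [Function.comp_apply, hφ, hΦ]
    rw [this]
  have h0 := h _ hinv
  rw [trace_mul_compress hv] at h0
  set ψ : (Fin n → ℂ) → ℝ := fun z => ‖Φ z‖ ^ 2 / (1 + ‖Φ z‖ ^ 2) with hψ
  have h1 : ∫ z, ((ψ z : ℝ) : ℂ) ∂(vlam n lam) = 0 := by
    rw [← h0]
    refine integral_congr_ae ?_
    filter_upwards [hmem.coeFn_toLp] with z hz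
    rw [hz]
    simp only [hφ, hψ]
    rw [div_mul_eq_mul_div]
    change _ = star (Φ z) * Φ z / _
    have : star (Φ z) * Φ z = ((‖Φ z‖ ^ 2 : ℝ) : ℂ) := by
      push_cast
      exact Complex.conj_mul' (Φ z)
    rw [this, Complex.ofReal_div]
  rw [integral_complex_ofReal] at h1
  have h2 : ∫ z, ψ z ∂(vlam n lam) = 0 := by exact_mod_cast h1
  have hψm : Measurable ψ :=
    (hΦm.norm.pow_const 2).div (measurable_const.add (hΦm.norm.pow_const 2))
  have hint : Integrable ψ (vlam n lam) := by
    refine Integrable.of_bound hψm.aestronglyMeasurable 1 (Eventually.of_forall fun z => ?_)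
    rw [Real.norm_of_nonneg (by positivity), hψ, div_le_one (by positivity)]
    linarith
  rw [integral_eq_zero_iff_of_nonneg (fun _ => by positivity) hint] at h2
  refine eq_zero_of_opKernel_diag hv C S ?_
  refine eqOn_of_ae_eq hv (g := fun _ => 0) isOpen_domain le_rfl (continuousOn_opKernel hv C S)
    continuousOn_const ?_
  filter_upwards [h2] with z hz _
  have h3 : 0 < 1 + ‖Φ z‖ ^ 2 := by positivity
  have hz' : ‖Φ z‖ ^ 2 / (1 + ‖Φ z‖ ^ 2) = 0 := hz
  rw [div_eq_zero_iff, or_iff_left h3.ne'] at hz'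
  simpa using hz'

/-- Every element of the commutant on a finite-dimensional invariant subspace is the compression of
a Toeplitz operator with invariant symbol. -/
theorem exists_compress_toeplitz_eq (hv : vlam n lam ≠ 0)
    (C : Submodule ℂ (bergman n lam)) [FiniteDimensional ℂ C] {H : Subgroup (SOxSO2 n)}
    (hC : UnitaryRep.IsInvariant ((piLam n lam).comp H.subtype) C) {S : C →ₗ[ℂ] C}
    (hS : S ∈ UnitaryRep.commutant ((piLam n lam).comp H.subtype) C) :
    ∃ a ∈ invariantSymbols lam H, UnitaryRep.compress C (toeplitz lam a) = S := by
  set 𝓔 := UnitaryRep.commutant ((piLam n lam).comp H.subtype) C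
  set 𝓣 : Submodule ℂ (C →ₗ[ℂ] C) :=
    (invariantSymbols lam H).map (UnitaryRep.compress C ∘ₗ toeplitzₗ n lam)
  have hle : 𝓣 ≤ 𝓔 := by
    rintro _ ⟨a, ha, rfl⟩
    exact UnitaryRep.compress_mem_commutant hC (toeplitz_mem_intertwiners ha)
  have heq : 𝓣 = 𝓔 := UnitaryRep.eq_of_trace_orthogonal hle fun X hX h =>
    eq_zero_of_trace_eq_zero hv C hC hX fun a ha => h _ ⟨a, ha, rfl⟩
  rw [← heq] at hS
  exact hS

/-- If the Toeplitz operators with invariant symbols commute, then the intertwiners commute on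
finite-dimensional invariant subspaces that are stable under all intertwiners. -/
theorem intertwiners_commute_of_toeplitz (hv : vlam n lam ≠ 0) {H : Subgroup (SOxSO2 n)}
    (C : Submodule ℂ (bergman n lam)) [FiniteDimensional ℂ C]
    (hC : UnitaryRep.IsInvariant ((piLam n lam).comp H.subtype) C)
    (hstable : ∀ T ∈ UnitaryRep.intertwiners ((piLam n lam).comp H.subtype), ∀ f ∈ C, T f ∈ C)
    (hcomm : ∀ a ∈ invariantSymbols lam H, ∀ b ∈ invariantSymbols lam H,
      toeplitz lam a * toeplitz lam b = toeplitz lam b * toeplitz lam a)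
    {S T : bergman n lam →L[ℂ] bergman n lam}
    (hS : S ∈ UnitaryRep.intertwiners ((piLam n lam).comp H.subtype))
    (hT : T ∈ UnitaryRep.intertwiners ((piLam n lam).comp H.subtype))
    {f : bergman n lam} (hf : f ∈ C) : S (T f) = T (S f) := by
  -- Both X and the Toeplitz operator preserve C, so equality of their compressions is equality on
  -- C.
  have key : ∀ X ∈ UnitaryRep.intertwiners ((piLam n lam).comp H.subtype),
      ∃ a ∈ invariantSymbols lam H, ∀ f ∈ C, X f = toeplitz lam a f := by
    intro X hX
    obtain ⟨a, ha, h⟩ := exists_compress_toeplitz_eq hv C hC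
      (UnitaryRep.compress_mem_commutant hC hX)
    refine ⟨a, ha, fun f hf => ?_⟩
    have h1 := congrArg (Subtype.val) (LinearMap.congr_fun h ⟨f, hf⟩)
    rw [UnitaryRep.coe_compress_apply C (hstable _ (toeplitz_mem_intertwiners ha) f hf),
      UnitaryRep.coe_compress_apply C (hstable _ hX f hf)] at h1
    exact h1.symm
  obtain ⟨a, ha, hSa⟩ := key S hS
  obtain ⟨b, hb, hTb⟩ := key T hT
  rw [hSa _ (hstable T hT f hf), hTb _ (hstable S hS f hf), hSa f hf, hTb f hf]
  exact congrArg (fun X : bergman n lam →L[ℂ] bergman n lam => X f) (hcomm a ha b hb)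

end CartanIV
end

/-! ### The equivalence. -/

theorem theorem3p9 (n : ℕ) (hn : 3 ≤ n) (lam : ℝ) (hlam : (n : ℝ) - 1 < lam)
    (H : Subgroup (CartanIV.SOxSO2 n)) (hH : IsClosed (H : Set (CartanIV.SOxSO2 n)))
    (hfin : ∀ C : Submodule ℂ (CartanIV.bergman n lam),
      UnitaryRep.IsIsotypicComponent ((CartanIV.piLam n lam).comp H.subtype) C →
        FiniteDimensional ℂ C) :
    List.TFAE [
      UnitaryRep.IsMultiplicityFree ((CartanIV.piLam n lam).comp H.subtype),
      ∀ S ∈ UnitaryRep.intertwiners ((CartanIV.piLam n lam).comp H.subtype),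
        ∀ T ∈ UnitaryRep.intertwiners ((CartanIV.piLam n lam).comp H.subtype), S * T = T * S,
      ∀ S ∈ CartanIV.toeplitzAlgebra lam
          (CartanIV.invariantSymbols lam H : Set (CartanIV.Linfty n lam)),
        ∀ T ∈ CartanIV.toeplitzAlgebra lam
          (CartanIV.invariantSymbols lam H : Set (CartanIV.Linfty n lam)), S * T = T * S] := by
  tfae_have 2 → 3 := by
    have hle : ∀ T ∈ CartanIV.toeplitzAlgebra lam
        (CartanIV.invariantSymbols lam H : Set (CartanIV.Linfty n lam)),
        T ∈ UnitaryRep.intertwiners ((CartanIV.piLam n lam).comp H.subtype) := by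
      refine fun T hT => UnitaryRep.cstarAlgebra_le_intertwiners ?_ hT
      rintro _ ⟨a, ha, rfl⟩
      exact CartanIV.toeplitz_mem_intertwiners ha
    exact fun h S hS T hT => h S (hle S hS) T (hle T hT)
  tfae_have 1 → 2 := by
    intro h S hS T hT
    by_cases hv : CartanIV.vlam n lam = 0
    · have := CartanIV.subsingleton_bergman hv
      exact Subsingleton.elim _ _
    · exact h.commute hfin (CartanIV.orthogonal_sSup_invariant_eq_bot hv H) hS hT
  tfae_have 3 → 1 := by
    rintro h _ ⟨V, hV, rfl⟩
    have := hfin _ ⟨V, hV, rfl⟩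
    by_cases hv : CartanIV.vlam n lam = 0
    · have := CartanIV.subsingleton_bergman hv
      exact absurd (Subsingleton.elim V ⊥) hV.2.1
    refine UnitaryRep.isIrreducible_isotypicSum hV fun S hS T hT f hf => ?_
    have hmem : ∀ a ∈ CartanIV.invariantSymbols lam H, CartanIV.toeplitz lam a ∈
        CartanIV.toeplitzAlgebra lam
          (CartanIV.invariantSymbols lam H : Set (CartanIV.Linfty n lam)) := fun a ha =>
      UnitaryRep.subset_cstarAlgebra _ ⟨a, ha, rfl⟩
    exact CartanIV.intertwiners_commute_of_toeplitz hv _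
      (UnitaryRep.isInvariant_isotypicSum _ V)
      (fun T hT f hf => UnitaryRep.intertwiner_mem_isotypicSum hT hf)
      (fun a ha b hb => h _ (hmem a ha) _ (hmem b hb)) hS hT hf
  tfae_finish
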